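/- Let $\Omega\subset\mathbb R^3$ be a bounded connected open set with $\operatorname{int}\overline\Omega=\Omega$ (for instance a connected axi-parallel polyhedron with Lipschitz boundary), and let $\mathcal T$ be a finite partition of $\Omega$ into pairwise disjoint open axi-parallel hexahedra $K\subset\Omega$ with $\overline\Omega=\bigcup_{K\in\mathcal T}\overline K$; anisotropic elements and hanging nodes are allowed, in particular $\mathcal T$ may be a geometric edge mesh. The interior faces are the two-dimensional intersections $f=\partial K^\sharp\cap\partial K^\flat$ of two elements, the boundary faces are the two-dimensional parts of $\partial K\cap\partial\Omega$ in one side of an element $K$, and $\mathcal F$ is the set of all faces. Let $k\ge 1$, and let $\mathcal Q_m(K)$ be the space of polynomials on $K$ of degree at most $m$ in each variable. Put $$V_h=\{v\in L^2(\Omega)^3: v|_K\in\mathcal Q_k(K)^3\ \forall K\in\mathcal T\},\qquad \widetilde Q_h=\{q\in L^2(\Omega): q|_K\in\mathcal Q_{k-1}(K)\ \forall K\in\mathcal T\},\qquad Q_h=\Big\{q\in\widetilde Q_h:\int_\Omega q\,dx=0\Big\}.$$ On an interior face let $\{w\}=\frac12(w|_{K^\sharp}+w|_{K^\flat})$, $[v]=v|_{K^\sharp}\cdot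 n_{K^\sharp}+v|_{K^\flat}\cdot n_{K^\flat}$ and $[\![v]\!]=v|_{K^\sharp}\otimes n_{K^\sharp}+v|_{K^\flat}\otimes n_{K^\flat}$, where $n_K$ is the outward unit normal of $K$; on a boundary face let $\{w\}=w$, $[v]=v\cdot n_\Omega$ and $[\![v]\!]=v\otimes n_\Omega$. Let $\mathtt h=h^\perp_{K,f}$ on a boundary face $f$ of $K$ and $\mathtt h=\min\{h^\perp_{K^\sharp,f},h^\perp_{K^\flat,f}\}$ on an interior face $f$, where $h^\perp_{K,f}$ is the extent of $K$ perpendicular to $f$. With $\nabla_h$ and $\nabla_h\cdot$ the elementwise gradient and divergence, $(\nabla v)_{ij}=\partial_jv_i$, a penalty parameter $\gamma>0$, $\theta\in[-1,1]$ and $\nu\in(0,\frac12]$, define $$A_h(u,v)=\int_\Omega\nabla_hu:\nabla_hv\,dx-\int_{\mathcal F}\big(\theta\{\nabla_hv\}:[\![u]\!]+\{\nabla_hu\}:[\![v]\!]\big)ds+\int_{\mathcal F}\gamma\,\mathtt h^{-1}k^2\,[\![u]\!]:[\![v]\!]\,ds,$$ $$B_h(v,q)=-\int_\Omega q\,\nabla_h\cdot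 v\,dx+\int_{\mathcal F}\{q\}[v]\,ds,\qquad C_h(p,q)=(1-2\nu)\int_\Omega pq\,dx.$$ Let $f\in L^2(\Omega)^3$. The mixed DG problem is to find $(u_h,p_h)\in V_h\times Q_h$ with $$A_h(u_h,v)+B_h(v,p_h)=\int_\Omega f\cdot v\,dx,\qquad -B_h(u_h,q)+C_h(p_h,q)=0\qquad\forall (v,q)\in V_h\times Q_h.$$ The augmented DG problem is to find $(\tilde u_h,\tilde p_h,\tilde r)\in V_h\times\widetilde Q_h\times\mathbb R$ with $$A_h(\tilde u_h,v)+B_h(v,\tilde p_h)=\int_\Omega f\cdot v\,dx,\qquad -B_h(\tilde u_h,q)+C_h(\tilde p_h,q)-\tilde r\int_\Omega q\,dx=0,\qquad \frac{s}{|\Omega|}\int_\Omega\tilde p_h\,dx-\tilde r s=0$$ for all $(v,q,s)\in V_h\times\widetilde Q_h\times\mathbb R$. (a) A triple $(u,p,r)\in V_h\times\widetilde Q_h\times\mathbb R$ solves the augmented problem if and only if $r=0$, $p\in Q_h$, and $(u,p)$ solves the mixed DG problem. (b) There is an absolute constant $\gamma_0>0$ (independent of $\Omega,\mathcal T,k,\theta,\nu,f$)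 such that, whenever $\gamma\ge\gamma_0$, the augmented problem has exactly one solution; it is of the form $(\tilde u_h,\tilde p_h,0)$, its pressure has zero mean, i.e. $\tilde p_h\in Q_h$, and $(\tilde u_h,\tilde p_h)$ is the unique solution of the mixed DG problem. -/

import Mathlib

open MeasureTheory

namespace MixedDG

/-- A finite partition of `Ω ⊆ ℝ³` into axi-parallel open hexahedra `K = ∏ i, (lower i, upper i)`.
Hanging nodes, hanging edges and anisotropic elements are allowed. -/
structure BoxMesh (Ω : Set (Fin 3 → ℝ)) where
  elems : Finset (BoxIntegral.Box (Fin 3))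
  subset : ∀ K ∈ elems, BoxIntegral.Box.Ioo K ⊆ Ω
  disjoint : ∀ K ∈ elems, ∀ L ∈ elems, K ≠ L →
    Disjoint (BoxIntegral.Box.Ioo K) (BoxIntegral.Box.Ioo L)
  cover : closure Ω = ⋃ K ∈ elems, BoxIntegral.Box.Icc K

variable {Ω : Set (Fin 3 → ℝ)}

/-- `V_h`: a polynomial vector field on each element, of degree at most `k` in each variable.
(An element of the broken space is the family of its restrictions to the elements.) -/
abbrev Velocity (T : BoxMesh Ω) (k : ℕ) : Type :=
  T.elems → Fin 3 → MvPolynomial.restrictDegree (Fin 3) ℝ k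

/-- The full pressure space: a polynomial on each element, of degree at most `k - 1` in each
variable, without mean value constraint. It is used for `1 ≤ k` only. -/
abbrev FullPressure (T : BoxMesh Ω) (k : ℕ) : Type :=
  T.elems → MvPolynomial.restrictDegree (Fin 3) ℝ (k - 1)

/-- A piecewise polynomial function, given by one polynomial for each element. -/
abbrev Broken (T : BoxMesh Ω) : Type := T.elems → MvPolynomial (Fin 3) ℝ

/-- The real function that a piecewise polynomial defines on the union of the (open) elements,
which is all of `Ω` up to a null set; it is extended by zero. -/
noncomputable def Broken.fn {T : BoxMesh Ω} (g : Broken T) (x : Fin 3 → ℝ) : ℝ :=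
  ∑ K : T.elems, (BoxIntegral.Box.Ioo K.1).indicator (fun y => MvPolynomial.eval y (g K)) x

/-- The component `v_i` of a discrete velocity. -/
def Velocity.comp {T : BoxMesh Ω} {k : ℕ} (v : Velocity T k) (i : Fin 3) : Broken T :=
  fun K => (v K i).1

/-- The entry `(∇_h v)_{ij} = ∂_j v_i` of the elementwise gradient. -/
noncomputable def Velocity.grad {T : BoxMesh Ω} {k : ℕ} (v : Velocity T k) (i j : Fin 3) :
    Broken T :=
  fun K => MvPolynomial.pderiv j (v K i).1

/-- The elementwise divergence `∇_h · v`. -/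
noncomputable def Velocity.div {T : BoxMesh Ω} {k : ℕ} (v : Velocity T k) : Broken T :=
  fun K => ∑ i, MvPolynomial.pderiv i (v K i).1

/-- A discrete pressure as a piecewise polynomial. -/
def FullPressure.toBroken {T : BoxMesh Ω} {k : ℕ} (q : FullPressure T k) : Broken T :=
  fun K => (q K).1

/-- `Q_h`: the discrete pressures with vanishing mean value on `Ω`. -/
def Pressure (T : BoxMesh Ω) (k : ℕ) : Set (FullPressure T k) :=
  {q | ∫ x in Ω, q.toBroken.fn x = 0}

/-! ### Faces -/

/-- `∂K ∩ ∂L` is a (two-dimensional) interior face perpendicular to `e_i`, with `K` below and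
`L` above the face. -/
def IsInteriorFace (K L : BoxIntegral.Box (Fin 3)) (i : Fin 3) : Prop :=
  K.upper i = L.lower i ∧ ∀ j, j ≠ i → max (K.lower j) (L.lower j) < min (K.upper j) (L.upper j)

/-- Interior faces `(K, L, i)`: each pair of neighbouring elements is listed exactly once. -/
abbrev InteriorFace (T : BoxMesh Ω) : Type :=
  {F : T.elems × T.elems × Fin 3 // IsInteriorFace F.1.1 F.2.1.1 F.2.2}

/-- Boundary faces `(K, i, s)`: the part of `∂K ∩ ∂Ω` in the side of `K` perpendicular to `e_i`,
in the upper side for `s = true` and in the lower side for `s = false`. (Where this part has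
zero area, it does not contribute to any integral.) -/
abbrev BoundaryFace (T : BoxMesh Ω) : Type := T.elems × Fin 3 × Bool

/-- All faces of the mesh. -/
abbrev Face (T : BoxMesh Ω) : Type := InteriorFace T ⊕ BoundaryFace T

noncomputable instance (T : BoxMesh Ω) : Fintype (Face T) := by
  classical
  exact inferInstance

/-- The `i`-th coordinate of the plane that contains a side of `K`. -/
def sideLevel (K : BoxIntegral.Box (Fin 3)) (i : Fin 3) (s : Bool) : ℝ :=
  if s then K.upper i else K.lower i

/-- The outward unit normal vector of `K` on a side. -/
def sideNormal (i : Fin 3) (s : Bool) : Fin 3 → ℝ :=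
  if s then Pi.single i 1 else -Pi.single i 1

/-- The direction perpendicular to the face. -/
def Face.axis {T : BoxMesh Ω} : Face T → Fin 3
  | .inl F => F.1.2.2
  | .inr F => F.2.1

/-- The face lies in the plane `x_axis = level`. -/
def Face.level {T : BoxMesh Ω} : Face T → ℝ
  | .inl F => sideLevel F.1.1.1 F.1.2.2 true
  | .inr F => sideLevel F.1.1 F.2.1 F.2.2

/-- The points of the face. -/
def Face.carrier {T : BoxMesh Ω} : Face T → Set (Fin 3 → ℝ)
  | .inl F => frontier (BoxIntegral.Box.Ioo F.1.1.1) ∩ frontier (BoxIntegral.Box.Ioo F.1.2.1.1)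
  | .inr F => {x ∈ BoxIntegral.Box.Icc F.1.1 | x F.2.1 = sideLevel F.1.1 F.2.1 F.2.2} ∩ frontier Ω

/-- The mesh function `h`: the extent of the adjacent element perpendicular to the face, and the
smaller one of the two extents for an interior face. -/
def Face.size {T : BoxMesh Ω} : Face T → ℝ
  | .inl F => min (F.1.1.1.upper F.1.2.2 - F.1.1.1.lower F.1.2.2)
      (F.1.2.1.1.upper F.1.2.2 - F.1.2.1.1.lower F.1.2.2)
  | .inr F => F.1.1.upper F.2.1 - F.1.1.lower F.2.1

/-- The average of a piecewise polynomial scalar function on a face. -/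
noncomputable def Face.avg {T : BoxMesh Ω} (g : Broken T) (x : Fin 3 → ℝ) : Face T → ℝ
  | .inl F => (MvPolynomial.eval x (g F.1.1) + MvPolynomial.eval x (g F.1.2.1)) / 2
  | .inr F => MvPolynomial.eval x (g F.1)

/-- The `j`-th component of the jump `g_K n_K + g_L n_L` (on a boundary face: `g_K n_Ω`) of a
piecewise polynomial scalar function on a face. -/
noncomputable def Face.jump {T : BoxMesh Ω} (g : Broken T) (j : Fin 3) (x : Fin 3 → ℝ) :
    Face T → ℝ
  | .inl F => MvPolynomial.eval x (g F.1.1) * sideNormal F.1.2.2 true j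
      + MvPolynomial.eval x (g F.1.2.1) * sideNormal F.1.2.2 false j
  | .inr F => MvPolynomial.eval x (g F.1) * sideNormal F.2.1 F.2.2 j

/-- The sum over all faces of the surface integrals of `g F`. A face lies in a coordinate plane,
which is parametrized by the two other coordinates. -/
noncomputable def integralFaces (T : BoxMesh Ω) (g : Face T → (Fin 3 → ℝ) → ℝ) : ℝ :=
  ∑ F : Face T, ∫ y in {y : Fin 2 → ℝ | F.axis.insertNth F.level y ∈ F.carrier},
    g F (F.axis.insertNth F.level y)

/-! ### The forms and the two discrete problems -/

/-- The interior penalty form `A_h`, with stabilization function `γ k² / h`. -/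
noncomputable def formA {T : BoxMesh Ω} {k : ℕ} (γ θ : ℝ) (u v : Velocity T k) : ℝ :=
  (∫ x in Ω, ∑ i, ∑ j, (u.grad i j).fn x * (v.grad i j).fn x)
  - integralFaces T (fun F x => ∑ i, ∑ j,
      (θ * (F.avg (v.grad i j) x * F.jump (u.comp i) j x)
        + F.avg (u.grad i j) x * F.jump (v.comp i) j x))
  + integralFaces T (fun F x => γ * F.size⁻¹ * (k : ℝ) ^ 2 *
      ∑ i, ∑ j, F.jump (u.comp i) j x * F.jump (v.comp i) j x)

/-- The form `B_h(v, q) = -∫_Ω q ∇_h·v + ∫_F {q} [v]`. -/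
noncomputable def formB {T : BoxMesh Ω} {k : ℕ} (v : Velocity T k) (q : FullPressure T k) : ℝ :=
  -(∫ x in Ω, q.toBroken.fn x * v.div.fn x)
  + integralFaces T (fun F x => F.avg q.toBroken x * ∑ j, F.jump (v.comp j) j x)

/-- The form `C_h(p, q) = (1 - 2ν) ∫_Ω p q`. -/
noncomputable def formC {T : BoxMesh Ω} {k : ℕ} (ν : ℝ) (p q : FullPressure T k) : ℝ :=
  (1 - 2 * ν) * ∫ x in Ω, p.toBroken.fn x * q.toBroken.fn x

/-- The load functional `∫_Ω f · v`. -/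
noncomputable def load {T : BoxMesh Ω} {k : ℕ} (f : (Fin 3 → ℝ) → Fin 3 → ℝ)
    (v : Velocity T k) : ℝ :=
  ∫ x in Ω, ∑ i, f x i * (v.comp i).fn x

/-- `(u, p) ∈ V_h × Q_h` solves the mixed discontinuous Galerkin problem. -/
def IsMixedSolution {T : BoxMesh Ω} {k : ℕ} (γ θ ν : ℝ) (f : (Fin 3 → ℝ) → Fin 3 → ℝ)
    (u : Velocity T k) (p : FullPressure T k) : Prop :=
  p ∈ Pressure T k ∧
  (∀ v : Velocity T k, formA γ θ u v + formB v p = load f v) ∧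
  (∀ q ∈ Pressure T k, -formB u q + formC ν p q = 0)

/-- `(u, p, r)`, with `p` in the full pressure space and `r ∈ ℝ`, solves the augmented problem. -/
def IsAugmentedSolution {T : BoxMesh Ω} {k : ℕ} (γ θ ν : ℝ) (f : (Fin 3 → ℝ) → Fin 3 → ℝ)
    (u : Velocity T k) (p : FullPressure T k) (r : ℝ) : Prop :=
  (∀ v : Velocity T k, formA γ θ u v + formB v p = load f v) ∧
  (∀ q : FullPressure T k,
    -formB u q + formC ν p q - r * ∫ x in Ω, q.toBroken.fn x = 0) ∧
  (∀ s : ℝ, s * (⨍ x in Ω, p.toBroken.fn x) - r * s = 0)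

end MixedDG

/-!
Testing the second equation of the augmented problem with `q = 1` gives `2 ν |Ω| r = 0`, because
`B_h(v, 1) = 0` for every discrete velocity; conversely every pressure is the sum of one with
vanishing mean and a constant. This is the equivalence of the two problems
(`isAugmentedSolution_iff`). The augmented problem is a square linear system, so for its unique
solvability it suffices that the mixed problem with `f = 0` has only the trivial solution
(`eq_zero_of_isMixedSolution`); testing with the solution itself reduces this to the definiteness of
`A_h` and to the injectivity of `B_h` on pressures with vanishing mean.

All identities rest on one geometric fact, `integral_side` and its summed form
`integralFaces_faceSum`: a side of an element is, up to a null set, the disjoint union of the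
interior faces in it and of its boundary part. A point of the side whose coordinates within the
plane of the side are generic is either in `∂Ω`, or points slightly outside of the element belong
to exactly one neighbour; `int (closure Ω) = Ω` excludes that both happen. With the divergence
theorem on each element this yields `formB_eq`,
`B_h(v, q) = ∑_K ∫_K ∇q · v + ∑_F ∫_F (q_L - q_K) (v_K + v_L)·e_i / 2`, the second sum being over
interior faces between `K` (below) and `L` (above).

*Definiteness of `A_h`.* On a face perpendicular to `e_j` only the derivatives `∂_j u_i` occur. The
trace inequality in the direction `e_j` has the constant `(k + 1)² / h^⊥ ≤ 4 k² / h^⊥`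
(`integral_side_sq_le`), derived from an explicit reproducing polynomial on `(0, 1)`; hence Young's
inequality gives coercivity for `γ ≥ 17` (`le_formA_self`), whatever the mesh and `k`. If the energy
vanishes, `u` is constant on each element without jumps, including those on `∂Ω`, and a non-zero
element with the highest upper side leads to a contradiction.

*Kernel of `B_h`.* If `B_h(v, q) = 0` for all `v`, the choice `v_i = ∂_i q (x_i - a_i) (b_i - x_i)`
on `K = ∏ (a_i, b_i)` shows that `q` is piecewise constant. An affine `v` with normal component
`∓ q_K` on the upper and lower sides turns `B_h(v, q)` into half the sum of the squared jumps of
`q`, and `q` is constant because the elements of a connected domain are linked through interior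
faces (`eq_univ_of_face_invariant`).
-/

namespace MixedDG

/-! ### The discrete trace inequality in one variable -/

/-- The first column of the inverse of the Hilbert matrix `(1 / (i + j + 1))`. The rational function
`t ↦ ∑ j, c j / (t + j + 1)` is a multiple of `∏_{i=1}^n (t - i) / ∏_{j=0}^n (t + j + 1)`, and the
coefficients are read off from the Lagrange interpolation of the numerator at `-1, …, -(n + 1)`. -/
theorem exists_hilbert_column (n : ℕ) : ∃ c : ℕ → ℝ,
    (∀ i ≤ n, ∑ j ∈ Finset.range (n + 1), c j / (i + j + 1) = if i = 0 then 1 else 0) ∧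
      c 0 = (n + 1) ^ 2 := by
  classical
  set s := Finset.range (n + 1) with hs
  set v : ℕ → ℝ := fun j => -(j + 1) with hv
  set N : Polynomial ℝ := Polynomial.C (((n : ℝ) + 1) * (-1) ^ n) *
    ∏ i ∈ Finset.range n, (Polynomial.X - Polynomial.C ((i : ℝ) + 1)) with hN
  have hinj : Set.InjOn v s := by
    intro a _ b _ h
    simpa [hv] using h
  have hmonic : (∏ i ∈ Finset.range n, (Polynomial.X - Polynomial.C ((i : ℝ) + 1))).natDegree
      = n := by
    rw [Polynomial.natDegree_finsetProd_X_sub_C_eq_card]; simp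
  have hdeg : N.degree < s.card := by
    have h1 : N.natDegree ≤ n := (Polynomial.natDegree_C_mul_le _ _).trans hmonic.le
    have h2 : N.degree ≤ (n : WithBot ℕ) := Polynomial.natDegree_le_iff_degree_le.mp h1
    refine h2.trans_lt ?_
    rw [hs, Finset.card_range]
    exact_mod_cast Nat.lt_succ_self n
  have hint := Lagrange.eq_interpolate (s := s) (v := v) hinj hdeg
  have hevalN : ∀ t : ℝ, N.eval t = (n + 1) * (-1) ^ n * ∏ i ∈ Finset.range n, (t - (i + 1)) := by
    intro t
    simp [hN, Polynomial.eval_prod]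
  refine ⟨fun j => Lagrange.nodalWeight s v j * N.eval (v j), ?_, ?_⟩
  · intro i hi
    have hne : ∀ j ∈ s, (i : ℝ) ≠ v j := by
      intro j _ h
      have : (0 : ℝ) ≤ i := i.cast_nonneg
      have : (0 : ℝ) ≤ j := j.cast_nonneg
      simp only [hv] at h
      linarith
    have h1 := Lagrange.eval_interpolate_not_at_node (s := s) (v := v)
      (fun j => N.eval (v j)) hne
    rw [← hint, Lagrange.eval_nodal] at h1
    have hprod : ∏ j ∈ s, ((i : ℝ) - v j) ≠ 0 :=
      Finset.prod_ne_zero_iff.mpr fun j hj => sub_ne_zero.mpr (hne j hj)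
    have h2 : ∑ j ∈ s, Lagrange.nodalWeight s v j * N.eval (v j) / (i + j + 1)
        = N.eval (i : ℝ) / ∏ j ∈ s, ((i : ℝ) - v j) := by
      rw [h1, mul_div_cancel_left₀ _ hprod]
      refine Finset.sum_congr rfl fun j _ => ?_
      have : (i : ℝ) - v j = i + j + 1 := by simp only [hv]; ring
      rw [this]; ring
    rw [h2, hevalN]
    rcases Nat.eq_zero_or_pos i with rfl | hpos
    · simp only [hv, hs, Nat.cast_zero, if_true, sub_neg_eq_add, zero_add, zero_sub]
      have e1 : ∏ j ∈ Finset.range (n + 1), ((j : ℝ) + 1) = (n + 1).factorial := by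
        rw [← Finset.prod_range_add_one_eq_factorial]; push_cast; rfl
      have e2 : ∏ j ∈ Finset.range n, (-((j : ℝ) + 1)) = (-1) ^ n * n.factorial := by
        rw [← Finset.prod_range_add_one_eq_factorial, Finset.prod_neg]; push_cast; simp
      rw [e1, e2, Nat.factorial_succ]
      have h3 : ((-1 : ℝ) ^ n) * (-1) ^ n = 1 := by rw [← mul_pow]; simp
      have h4 : (n.factorial : ℝ) ≠ 0 := by positivity
      rw [div_eq_one_iff_eq (by positivity)]
      push_cast
      linear_combination ((n : ℝ) + 1) * n.factorial * h3
    · rw [if_neg hpos.ne']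
      have : ∏ j ∈ Finset.range n, ((i : ℝ) - (j + 1)) = 0 := by
        refine Finset.prod_eq_zero (i := i - 1) (by simp; omega) ?_
        rw [Nat.cast_sub hpos]; simp
      rw [this]; simp
  · have e0 : s.erase 0 = (Finset.range n).map ⟨Nat.succ, Nat.succ_injective⟩ := by
      ext a; simp [hs]; cases a <;> simp
    have e1 : Lagrange.nodalWeight s v 0 = ((n.factorial : ℝ))⁻¹ := by
      rw [Lagrange.nodalWeight, e0, Finset.prod_map, Finset.prod_inv_distrib,
        ← Finset.prod_range_add_one_eq_factorial]
      push_cast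
      congr 1
      refine Finset.prod_congr rfl fun j _ => ?_
      simp [hv]
    have e2 : ∏ j ∈ Finset.range n, (v 0 - ((j : ℝ) + 1)) = (-1) ^ n * (n + 1).factorial := by
      rw [← Finset.prod_range_add_one_eq_factorial, Finset.prod_range_succ']
      push_cast
      have : ∀ j ∈ Finset.range n, v 0 - ((j : ℝ) + 1) = -((j : ℝ) + 1 + 1) := by
        intro j _; simp [hv]; ring
      rw [Finset.prod_congr rfl this, Finset.prod_neg]; simp
    have h3 : ((-1 : ℝ) ^ n) * (-1) ^ n = 1 := by rw [← mul_pow]; simp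
    have h4 : (n.factorial : ℝ) ≠ 0 := by positivity
    simp only [hevalN, e1, e2, Nat.factorial_succ]
    push_cast
    field_simp
    linear_combination h3

/-- Polynomials of degree at most `n` on `(0, 1)` have a reproducing polynomial for the evaluation
at `0`. -/
theorem exists_reproducing_polynomial (n : ℕ) : ∃ R : Polynomial ℝ, R.natDegree ≤ n ∧
    R.eval 0 = (n + 1) ^ 2 ∧
    ∀ P : Polynomial ℝ, P.natDegree ≤ n → ∫ t in (0 : ℝ)..1, P.eval t * R.eval t = P.eval 0 := by
  obtain ⟨c, hc, hc0⟩ := exists_hilbert_column n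
  refine ⟨∑ j ∈ Finset.range (n + 1), Polynomial.C (c j) * Polynomial.X ^ j, ?_, ?_, ?_⟩
  · refine Polynomial.natDegree_sum_le_of_forall_le _ _ fun j hj => ?_
    exact (Polynomial.natDegree_C_mul_X_pow_le _ _).trans (by simp at hj; omega)
  · simp [Polynomial.eval_finsetSum, hc0, Finset.sum_range_succ']
  · intro P hP
    have hPe : ∀ t, P.eval t = ∑ i ∈ Finset.range (n + 1), P.coeff i * t ^ i := fun t =>
      Polynomial.eval_eq_sum_range' (Nat.lt_succ_of_le hP) t
    have h1 : ∀ t, P.eval t * (∑ j ∈ Finset.range (n + 1),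
          Polynomial.C (c j) * Polynomial.X ^ j).eval t
        = ∑ i ∈ Finset.range (n + 1), ∑ j ∈ Finset.range (n + 1),
            (P.coeff i * c j) * t ^ (i + j) := by
      intro t
      rw [hPe, Polynomial.eval_finsetSum, Finset.sum_mul_sum]
      refine Finset.sum_congr rfl fun i _ => Finset.sum_congr rfl fun j _ => ?_
      simp; ring
    simp only [h1]
    rw [intervalIntegral.integral_finsetSum
      fun i _ => Continuous.intervalIntegrable (by fun_prop) _ _]
    have h2 : ∀ i ∈ Finset.range (n + 1), (∫ t in (0 : ℝ)..1, ∑ j ∈ Finset.range (n + 1),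
        (P.coeff i * c j) * t ^ (i + j)) = P.coeff i * if i = 0 then 1 else 0 := by
      intro i hi
      rw [intervalIntegral.integral_finsetSum
        fun j _ => Continuous.intervalIntegrable (by fun_prop) _ _,
        ← hc i (by simp at hi; omega), Finset.mul_sum]
      refine Finset.sum_congr rfl fun j _ => ?_
      rw [intervalIntegral.integral_const_mul, integral_pow]
      simp
      ring
    rw [Finset.sum_congr rfl h2]
    simp [← Polynomial.coeff_zero_eq_eval_zero]

/-- The trace inequality at the end point of `(0, 1)`: Cauchy-Schwarz against the reproducing
polynomial, whose squared norm is its value `(n + 1)²` at `0`. -/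
theorem sq_eval_zero_le (n : ℕ) (P : Polynomial ℝ) (hP : P.natDegree ≤ n) :
    P.eval 0 ^ 2 ≤ (n + 1) ^ 2 * ∫ t in (0 : ℝ)..1, P.eval t ^ 2 := by
  obtain ⟨R, hR, hR0, hrep⟩ := exists_reproducing_polynomial n
  set m : ℝ := (n + 1) ^ 2 with hm
  have hmpos : 0 < m := by positivity
  have h0 : 0 ≤ ∫ t in (0 : ℝ)..1, (m * P.eval t - P.eval 0 * R.eval t) ^ 2 :=
    intervalIntegral.integral_nonneg zero_le_one fun t _ => sq_nonneg _
  have h1 : ∀ t : ℝ, (m * P.eval t - P.eval 0 * R.eval t) ^ 2 = m ^ 2 * P.eval t ^ 2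
      - (2 * m * P.eval 0) * (P.eval t * R.eval t) + P.eval 0 ^ 2 * (R.eval t * R.eval t) := by
    intro t; ring
  have cP := P.continuous
  have cR := R.continuous
  simp only [h1] at h0
  rw [intervalIntegral.integral_add (Continuous.intervalIntegrable (by fun_prop) _ _)
      (Continuous.intervalIntegrable (by fun_prop) _ _),
    intervalIntegral.integral_sub (Continuous.intervalIntegrable (by fun_prop) _ _)
      (Continuous.intervalIntegrable (by fun_prop) _ _),
    intervalIntegral.integral_const_mul, intervalIntegral.integral_const_mul,
    intervalIntegral.integral_const_mul, hrep P hP, hrep R hR, hR0] at h0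
  have h2 : 0 ≤ m * (m * (∫ t in (0 : ℝ)..1, P.eval t ^ 2) - P.eval 0 ^ 2) := by
    linear_combination h0
  linarith [(mul_nonneg_iff_of_pos_left hmpos).mp h2]

/-- The trace inequality on an interval `[a, b]`, at the end point `a` or `b`. The constant has the
optimal order `n² / (b - a)`, which makes the penalty threshold independent of the degree. -/
theorem sq_eval_endpoint_le (n : ℕ) (P : Polynomial ℝ) (hP : P.natDegree ≤ n) {a b : ℝ}
    (hab : a < b) (s : Bool) :
    (b - a) * P.eval (if s then b else a) ^ 2 ≤ (n + 1) ^ 2 * ∫ t in Set.Icc a b, P.eval t ^ 2 := by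
  set c := if s then b else a
  set d := if s then a - b else b - a with hd
  have hdeg : (P.comp (Polynomial.C c + Polynomial.C d * Polynomial.X)).natDegree ≤ n := by
    refine (Polynomial.natDegree_comp_le).trans ?_
    have : (Polynomial.C c + Polynomial.C d * Polynomial.X).natDegree ≤ 1 := by
      rw [add_comm]; exact Polynomial.natDegree_linear_le
    calc _ ≤ n * 1 := Nat.mul_le_mul hP this
      _ = n := mul_one n
  have h := sq_eval_zero_le n _ hdeg
  simp only [Polynomial.eval_comp, Polynomial.eval_add, Polynomial.eval_C, Polynomial.eval_mul,
    Polynomial.eval_X, mul_zero, add_zero] at h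
  have hd0 : d ≠ 0 := by
    cases s <;> simp [hd] <;> linarith
  rw [intervalIntegral.integral_comp_add_mul (fun t => P.eval t ^ 2) hd0] at h
  have key : (d⁻¹ • ∫ t in c + d * 0..c + d * 1, P.eval t ^ 2)
      = (b - a)⁻¹ * ∫ t in Set.Icc a b, P.eval t ^ 2 := by
    rw [integral_Icc_eq_integral_Ioc, ← intervalIntegral.integral_of_le hab.le, smul_eq_mul]
    cases s
    · simp [c, hd]
    · simp only [c, hd, if_true, mul_zero, add_zero, mul_one, add_sub_cancel]
      rw [intervalIntegral.integral_symm, ← neg_sub b a, inv_neg]; ring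
  rw [key] at h
  have hpos : 0 < b - a := sub_pos.mpr hab
  calc (b - a) * P.eval c ^ 2
      ≤ (b - a) * ((n + 1) ^ 2 * ((b - a)⁻¹ * ∫ t in Set.Icc a b, P.eval t ^ 2)) :=
        mul_le_mul_of_nonneg_left h hpos.le
    _ = _ := by field_simp

/-! ### Polynomials in several variables -/

theorem hasFDerivAt_eval {n : ℕ} (p : MvPolynomial (Fin n) ℝ) (x : Fin n → ℝ) :
    HasFDerivAt (fun y => MvPolynomial.eval y p)
      (∑ i, MvPolynomial.eval x (MvPolynomial.pderiv i p) •
        (ContinuousLinearMap.proj i : (Fin n → ℝ) →L[ℝ] ℝ)) x := by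
  induction p using MvPolynomial.induction_on with
  | C a => simpa using hasFDerivAt_const a x
  | add p q hp hq =>
    simp only [map_add, add_smul, Finset.sum_add_distrib]
    exact hp.add hq
  | mul_X p j hp =>
    have h := hp.mul (hasFDerivAt_apply (𝕜 := ℝ) j x)
    simp only [map_mul, MvPolynomial.eval_X]
    refine h.congr_fderiv ?_
    ext v
    simp only [MvPolynomial.pderiv_mul, MvPolynomial.pderiv_X, Pi.single_apply, map_add, map_mul,
      MvPolynomial.eval_X, add_smul, Finset.sum_add_distrib, add_apply,
      smul_apply, sum_apply, ContinuousLinearMap.proj_apply,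
      smul_eq_mul, apply_ite (MvPolynomial.eval x), map_zero, mul_ite, mul_one, mul_zero,
      ite_mul, zero_mul, Finset.sum_ite_eq, Finset.mem_univ, if_true,
      Finset.mul_sum]
    rw [add_comm]
    congr 1
    exact Finset.sum_congr rfl fun i _ => by ring

/-- The restriction of a polynomial to a line parallel to the `i`-th axis. -/
theorem exists_eval_insertNth {n : ℕ} (p : MvPolynomial (Fin (n + 1)) ℝ) (i : Fin (n + 1))
    (y : Fin n → ℝ) : ∃ P : Polynomial ℝ, P.natDegree ≤ p.degreeOf i ∧
      ∀ t, P.eval t = MvPolynomial.eval (i.insertNth t y : Fin (n + 1) → ℝ) p := by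
  classical
  refine ⟨∑ m ∈ p.support, Polynomial.C (p.coeff m * ∏ j, y j ^ m (i.succAbove j)) *
    Polynomial.X ^ m i, ?_, fun t => ?_⟩
  · refine Polynomial.natDegree_sum_le_of_forall_le _ _ fun m hm => ?_
    exact (Polynomial.natDegree_C_mul_X_pow_le _ _).trans
      (MvPolynomial.degreeOf_le_iff.mp le_rfl m hm)
  · rw [MvPolynomial.eval_eq', Polynomial.eval_finsetSum]
    refine Finset.sum_congr rfl fun m _ => ?_
    rw [Fin.prod_univ_succAbove _ i]
    simp [Polynomial.eval_prod]
    ring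

theorem eq_C_of_pderiv_eq_zero {σ : Type*} {p : MvPolynomial σ ℝ}
    (h : ∀ i, MvPolynomial.pderiv i p = 0) : p = MvPolynomial.C (p.coeff 0) := by
  classical
  ext m
  rw [MvPolynomial.coeff_C]
  split_ifs with hm
  · rw [hm]
  · obtain ⟨i, hi⟩ : ∃ i, m i ≠ 0 := by
      by_contra! hcon
      exact hm (Finsupp.ext fun i => (hcon i).symm)
    have h1 := congrArg (MvPolynomial.coeff (m - Finsupp.single i 1)) (h i)
    have h2 : m - Finsupp.single i 1 + Finsupp.single i 1 = m :=
      tsub_add_cancel_of_le (by simpa [Nat.one_le_iff_ne_zero] using hi)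
    rw [MvPolynomial.coeff_pderiv, h2] at h1
    simp only [MvPolynomial.coeff_zero, mul_eq_zero] at h1
    rcases h1 with h1 | h1
    · exact h1
    · exfalso
      exact absurd h1 (by positivity)

theorem degreeOf_pderiv_le {σ : Type*} [DecidableEq σ] (p : MvPolynomial σ ℝ) (i j : σ) :
    (MvPolynomial.pderiv i p).degreeOf j ≤ p.degreeOf j - if j = i then 1 else 0 := by
  rw [MvPolynomial.degreeOf_le_iff]
  intro m hm
  rw [MvPolynomial.mem_support_iff, MvPolynomial.coeff_pderiv] at hm
  have h1 := MvPolynomial.degreeOf_le_iff.mp (le_refl (p.degreeOf j)) _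
    (MvPolynomial.mem_support_iff.mpr (left_ne_zero_of_mul hm))
  rw [Finsupp.add_apply, Finsupp.single_apply] at h1
  simp only [eq_comm (a := i)] at h1
  omega

theorem mem_restrictDegree_iff_degreeOf {σ : Type*} {p : MvPolynomial σ ℝ} {n : ℕ} :
    p ∈ MvPolynomial.restrictDegree σ ℝ n ↔ ∀ i, p.degreeOf i ≤ n := by
  rw [MvPolynomial.mem_restrictDegree]
  simp only [MvPolynomial.degreeOf_le_iff]
  exact ⟨fun h i m hm => h m hm i, fun h m hm i => h i m hm⟩

variable {Ω : Set (Fin 3 → ℝ)}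

/-! ### Faces and generic points -/

theorem mem_Ioo_box {K : BoxIntegral.Box (Fin 3)} {x : Fin 3 → ℝ} :
    x ∈ BoxIntegral.Box.Ioo K ↔ ∀ j, K.lower j < x j ∧ x j < K.upper j := by
  change x ∈ Set.univ.pi (fun i => Set.Ioo (K.lower i) (K.upper i)) ↔ _
  simp

theorem mem_Icc_box {n : ℕ} {K : BoxIntegral.Box (Fin n)} {x : Fin n → ℝ} :
    x ∈ BoxIntegral.Box.Icc K ↔ ∀ j, K.lower j ≤ x j ∧ x j ≤ K.upper j := by
  rw [BoxIntegral.Box.Icc_eq_pi, Set.mem_univ_pi]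
  rfl

theorem isOpen_Ioo_box (K : BoxIntegral.Box (Fin 3)) : IsOpen (BoxIntegral.Box.Ioo K) :=
  isOpen_set_pi Set.finite_univ fun _ _ => isOpen_Ioo

theorem closure_Ioo_box (K : BoxIntegral.Box (Fin 3)) :
    closure (BoxIntegral.Box.Ioo K) = BoxIntegral.Box.Icc K := by
  rw [BoxIntegral.Box.Icc_eq_pi]
  change closure (Set.univ.pi fun i => Set.Ioo (K.lower i) (K.upper i)) = _
  rw [closure_pi_set]
  simp only [closure_Ioo (K.lower_ne_upper _)]

/-- All coordinates of the planes that contain the sides of the elements. -/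
def BoxMesh.gridValues (T : BoxMesh Ω) : Set ℝ :=
  ⋃ K ∈ T.elems, Set.range K.lower ∪ Set.range K.upper

theorem BoxMesh.finite_gridValues (T : BoxMesh Ω) : T.gridValues.Finite :=
  T.elems.finite_toSet.biUnion fun _ _ => (Set.finite_range _).union (Set.finite_range _)

/-- A point whose coordinates other than the `i`-th one avoid all grid planes. The line through it
in the direction `e_i` meets the sides of elements in their relative interior only. -/
def BoxMesh.IsGeneric (T : BoxMesh Ω) (i : Fin 3) (x : Fin 3 → ℝ) : Prop :=
  ∀ j, j ≠ i → x j ∉ T.gridValues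

theorem BoxMesh.IsGeneric.lt {T : BoxMesh Ω} {i : Fin 3} {x : Fin 3 → ℝ} (hx : T.IsGeneric i x)
    {K : BoxIntegral.Box (Fin 3)} (hK : K ∈ T.elems) (hxK : x ∈ BoxIntegral.Box.Icc K)
    {j : Fin 3} (hj : j ≠ i) : K.lower j < x j ∧ x j < K.upper j := by
  have h := hx j hj
  simp only [BoxMesh.gridValues, Set.mem_iUnion, not_exists] at h
  have h' := h K hK
  simp only [Set.mem_union, Set.mem_range, not_or, not_exists] at h'
  have h2 := mem_Icc_box.mp hxK j
  exact ⟨lt_of_le_of_ne h2.1 (h'.1 j), lt_of_le_of_ne h2.2 (Ne.symm (h'.2 j))⟩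

/-- Two elements that meet in a generic point lie one behind the other in the direction `e_i`:
otherwise a shift of the point along `e_i` would be in the interior of both. -/
theorem BoxMesh.IsGeneric.separated {T : BoxMesh Ω} {i : Fin 3} {x : Fin 3 → ℝ}
    (hx : T.IsGeneric i x) {K L : BoxIntegral.Box (Fin 3)} (hK : K ∈ T.elems) (hL : L ∈ T.elems)
    (hKL : K ≠ L) (hxK : x ∈ BoxIntegral.Box.Icc K) (hxL : x ∈ BoxIntegral.Box.Icc L) :
    K.upper i ≤ L.lower i ∨ L.upper i ≤ K.lower i := by
  by_contra! hcon
  obtain ⟨t, ht1, ht2⟩ : ∃ t, max (K.lower i) (L.lower i) < t ∧ t < min (K.upper i) (L.upper i) :=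
    exists_between (by
      simp only [max_lt_iff, lt_min_iff]
      exact ⟨⟨K.lower_lt_upper i, hcon.1⟩, hcon.2, L.lower_lt_upper i⟩)
  simp only [max_lt_iff, lt_min_iff] at ht1 ht2
  have hmem : ∀ M ∈ T.elems, x ∈ BoxIntegral.Box.Icc M → M.lower i < t → t < M.upper i →
      Function.update x i t ∈ BoxIntegral.Box.Ioo M := by
    intro M hM hxM h1 h2
    rw [mem_Ioo_box]
    intro j
    rcases eq_or_ne j i with rfl | hj
    · simpa using ⟨h1, h2⟩
    · simpa [hj] using hx.lt hM hxM hj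
  exact Set.disjoint_left.mp (T.disjoint K hK L hL hKL) (hmem K hK hxK ht1.1 ht2.1)
    (hmem L hL hxL ht1.2 ht2.2)

theorem BoxMesh.Icc_subset_closure (T : BoxMesh Ω) {K : BoxIntegral.Box (Fin 3)}
    (hK : K ∈ T.elems) : BoxIntegral.Box.Icc K ⊆ closure Ω := by
  rw [T.cover]
  exact Set.subset_biUnion_of_mem (u := fun K => BoxIntegral.Box.Icc K) hK

/-- The neighbour relation with a sign: `L` is adjacent to the side `s` of `K` perpendicular
to `e_i`. -/
def IsNeighbour (K L : BoxIntegral.Box (Fin 3)) (i : Fin 3) (s : Bool) : Prop :=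
  if s then IsInteriorFace K L i else IsInteriorFace L K i

/-- A generic point of a side of `K` that is not in `∂Ω` belongs to a neighbour of `K`: points
slightly outside of `K` are still in `Ω`, hence in an element. -/
theorem exists_neighbour (hΩ : interior (closure Ω) = Ω) (T : BoxMesh Ω)
    {K : BoxIntegral.Box (Fin 3)} (hK : K ∈ T.elems) {i : Fin 3} {s : Bool} {x : Fin 3 → ℝ}
    (hx : T.IsGeneric i x) (hxK : x ∈ BoxIntegral.Box.Icc K) (hxi : x i = sideLevel K i s)
    (hxΩ : x ∉ frontier Ω) :
    ∃ L ∈ T.elems, IsNeighbour K L i s ∧ x ∈ BoxIntegral.Box.Icc L := by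
  have hopen : IsOpen Ω := hΩ ▸ isOpen_interior
  have hxin : x ∈ Ω := by
    by_contra hcon
    exact hxΩ (by rw [hopen.frontier_eq]; exact ⟨T.Icc_subset_closure hK hxK, hcon⟩)
  -- the outward direction on the side `s`
  set ε : ℝ := if s then 1 else -1 with hε
  have hcont : Continuous fun δ : ℝ => Function.update x i (x i + ε * δ) := by fun_prop
  -- a shift by a small `δ` does not leave `Ω`, nor does it cross a grid plane
  have hev : ∀ᶠ δ : ℝ in nhdsWithin 0 (Set.Ioi 0), Function.update x i (x i + ε * δ) ∈ Ω ∧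
      ∀ L ∈ T.elems, (x i < L.lower i → x i + ε * δ < L.lower i) ∧
        (L.upper i < x i → L.upper i < x i + ε * δ) := by
    refine Filter.Eventually.and ?_ ?_
    · refine nhdsWithin_le_nhds (hcont.continuousAt.eventually_mem (hopen.mem_nhds ?_))
      simpa using hxin
    · rw [Filter.eventually_all_finset]
      intro L _
      have hc : ContinuousAt (fun δ : ℝ => x i + ε * δ) 0 := by fun_prop
      refine nhdsWithin_le_nhds (Filter.Eventually.and ?_ ?_)
      · by_cases h : x i < L.lower i
        · exact (hc.eventually_lt_const (by simpa using h)).mono fun _ h' _ => h'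
        · exact Filter.Eventually.of_forall fun _ h' => absurd h' h
      · by_cases h : L.upper i < x i
        · exact (hc.eventually_const_lt (by simpa using h)).mono fun _ h' _ => h'
        · exact Filter.Eventually.of_forall fun _ h' => absurd h' h
  obtain ⟨δ, ⟨hδΩ, hδ⟩, hδpos⟩ := (hev.and self_mem_nhdsWithin).exists
  have hδpos : 0 < δ := hδpos
  have hcl := subset_closure hδΩ
  rw [T.cover] at hcl
  simp only [Set.mem_iUnion] at hcl
  obtain ⟨L, hL, hzL⟩ := hcl
  rw [mem_Icc_box] at hzL
  have hzi := hzL i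
  simp only [Function.update_self] at hzi
  have hxL : x ∈ BoxIntegral.Box.Icc L := by
    rw [mem_Icc_box]
    intro j
    rcases eq_or_ne j i with rfl | hj
    · constructor
      · by_contra! h; linarith [(hδ L hL).1 h]
      · by_contra! h; linarith [(hδ L hL).2 h]
    · simpa [hj] using hzL j
  have hKL : K ≠ L := by
    rintro rfl
    cases s <;> simp [sideLevel, hε] at hxi hzi <;> linarith
  have hsep := hx.separated hK hL hKL hxK hxL
  have hxLi := mem_Icc_box.mp hxL i
  have hpos : ∀ j, j ≠ i → max (K.lower j) (L.lower j) < min (K.upper j) (L.upper j) := by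
    intro j hj
    have h1 := hx.lt hK hxK hj
    have h2 := hx.lt hL hxL hj
    exact (max_lt h1.1 h2.1).trans (lt_min h1.2 h2.2)
  refine ⟨L, hL, ?_, hxL⟩
  cases s
  · simp only [sideLevel, hε, Bool.false_eq_true, if_false] at hxi hzi
    refine ⟨?_, fun j hj => by rw [max_comm, min_comm]; exact hpos j hj⟩
    rcases hsep with h | h
    · linarith [K.lower_lt_upper i]
    · linarith
  · simp only [sideLevel, hε, if_true] at hxi hzi
    refine ⟨?_, hpos⟩
    rcases hsep with h | h
    · linarith
    · linarith [K.lower_lt_upper i]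

/-- A generic point of an interior face is in the interior of the union of the two elements. -/
theorem mem_of_isInteriorFace (hΩ : interior (closure Ω) = Ω) (T : BoxMesh Ω)
    {K L : BoxIntegral.Box (Fin 3)} (hK : K ∈ T.elems) (hL : L ∈ T.elems) {i : Fin 3}
    (hKL : IsInteriorFace K L i) {x : Fin 3 → ℝ} (hx : T.IsGeneric i x)
    (hxK : x ∈ BoxIntegral.Box.Icc K) (hxL : x ∈ BoxIntegral.Box.Icc L) : x ∈ Ω := by
  rw [← hΩ, mem_interior_iff_mem_nhds]
  have hxi : x i = K.upper i := by
    have h1 := (mem_Icc_box.mp hxK i).2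
    have h2 := (mem_Icc_box.mp hxL i).1
    linarith [hKL.1]
  have hev : ∀ j, ∀ᶠ z : Fin 3 → ℝ in nhds x, (j ≠ i → (K.lower j < z j ∧ z j < K.upper j) ∧
      (L.lower j < z j ∧ z j < L.upper j)) ∧ (j = i → K.lower j < z j ∧ z j < L.upper j) := by
    intro j
    have hc : ContinuousAt (fun z : Fin 3 → ℝ => z j) x := (continuous_apply j).continuousAt
    rcases eq_or_ne j i with rfl | hj
    · have h1 : K.lower j < x j := hxi ▸ K.lower_lt_upper j
      have h2 : x j < L.upper j := by rw [hxi, hKL.1]; exact L.lower_lt_upper j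
      filter_upwards [hc.eventually_const_lt h1, hc.eventually_lt_const h2] with z h1 h2
      exact ⟨fun h => absurd rfl h, fun _ => ⟨h1, h2⟩⟩
    · have h1 := hx.lt hK hxK hj
      have h2 := hx.lt hL hxL hj
      filter_upwards [hc.eventually_const_lt h1.1, hc.eventually_lt_const h1.2,
        hc.eventually_const_lt h2.1, hc.eventually_lt_const h2.2] with z a b c d
      exact ⟨fun _ => ⟨⟨a, b⟩, c, d⟩, fun h => absurd h hj⟩
  filter_upwards [Filter.eventually_all.mpr hev] with z hz
  rcases le_total (z i) (K.upper i) with h | h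
  · refine T.Icc_subset_closure hK (mem_Icc_box.mpr fun j => ?_)
    rcases eq_or_ne j i with rfl | hj
    · exact ⟨((hz j).2 rfl).1.le, h⟩
    · exact ⟨((hz j).1 hj).1.1.le, ((hz j).1 hj).1.2.le⟩
  · refine T.Icc_subset_closure hL (mem_Icc_box.mpr fun j => ?_)
    rcases eq_or_ne j i with rfl | hj
    · exact ⟨hKL.1 ▸ h, ((hz j).2 rfl).2.le⟩
    · exact ⟨((hz j).1 hj).2.1.le, ((hz j).1 hj).2.2.le⟩

/-! ### Decomposition of the sides of the elements into faces -/

/-- The parameter domain of a face in the plane that contains it. -/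
def Face.dom {T : BoxMesh Ω} (F : Face T) : Set (Fin 2 → ℝ) :=
  {y | F.axis.insertNth F.level y ∈ F.carrier}

/-- The element below (`s = true`) or above (`s = false`) an interior face: the face is part of its
side `s`. -/
def InteriorFace.elem {T : BoxMesh Ω} (F : InteriorFace T) (s : Bool) : T.elems :=
  if s then F.1.1 else F.1.2.1

theorem InteriorFace.isNeighbour {T : BoxMesh Ω} (F : InteriorFace T) (s : Bool) :
    IsNeighbour (F.elem s).1 (F.elem !s).1 F.1.2.2 s := by
  cases s <;> exact F.2

theorem InteriorFace.level_eq {T : BoxMesh Ω} (F : InteriorFace T) (s : Bool) :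
    Face.level (.inl F : Face T) = sideLevel (F.elem s).1 F.1.2.2 s := by
  cases s
  · exact F.2.1
  · rfl

theorem insertNth_mem_Icc_box {K : BoxIntegral.Box (Fin 3)} {i : Fin 3} {t : ℝ} {y : Fin 2 → ℝ} :
    (i.insertNth t y : Fin 3 → ℝ) ∈ BoxIntegral.Box.Icc K ↔
      (K.lower i ≤ t ∧ t ≤ K.upper i) ∧ y ∈ BoxIntegral.Box.Icc (K.face i) := by
  rw [mem_Icc_box, mem_Icc_box, Fin.forall_iff_succAbove i]
  simp [BoxIntegral.Box.face]

theorem mem_frontier_Ioo_box {K : BoxIntegral.Box (Fin 3)} {x : Fin 3 → ℝ} {i : Fin 3} {s : Bool}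
    (hx : x i = sideLevel K i s) :
    x ∈ frontier (BoxIntegral.Box.Ioo K) ↔ x ∈ BoxIntegral.Box.Icc K := by
  rw [(isOpen_Ioo_box K).frontier_eq, closure_Ioo_box]
  refine ⟨fun h => h.1, fun h => ⟨h, fun h' => ?_⟩⟩
  have := mem_Ioo_box.mp h' i
  cases s <;> simp [sideLevel] at hx <;> linarith

theorem mem_dom_inl {T : BoxMesh Ω} {F : InteriorFace T} {y : Fin 2 → ℝ} :
    y ∈ Face.dom (.inl F : Face T) ↔ ∀ s,
      (F.1.2.2.insertNth (Face.level (.inl F : Face T)) y : Fin 3 → ℝ) ∈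
        BoxIntegral.Box.Icc (F.elem s).1 := by
  change (F.1.2.2.insertNth (Face.level (.inl F : Face T)) y : Fin 3 → ℝ) ∈
    frontier (BoxIntegral.Box.Ioo F.1.1.1) ∩ frontier (BoxIntegral.Box.Ioo F.1.2.1.1) ↔ _
  rw [Set.mem_inter_iff, mem_frontier_Ioo_box (i := F.1.2.2) (s := true)
      (by rw [Fin.insertNth_apply_same]; exact F.level_eq true),
    mem_frontier_Ioo_box (i := F.1.2.2) (s := false)
      (by rw [Fin.insertNth_apply_same]; exact F.level_eq false), Bool.forall_bool]
  exact and_comm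

theorem mem_dom_inr {T : BoxMesh Ω} {F : BoundaryFace T} {y : Fin 2 → ℝ} :
    y ∈ Face.dom (.inr F : Face T) ↔ y ∈ BoxIntegral.Box.Icc (F.1.1.face F.2.1) ∧
      (F.2.1.insertNth (sideLevel F.1.1 F.2.1 F.2.2) y : Fin 3 → ℝ) ∈ frontier Ω := by
  change ((_ ∈ BoxIntegral.Box.Icc F.1.1 ∧ _) ∧ _) ↔ _
  change ((F.2.1.insertNth (sideLevel F.1.1 F.2.1 F.2.2) y : Fin 3 → ℝ) ∈ _ ∧
    (F.2.1.insertNth (sideLevel F.1.1 F.2.1 F.2.2) y : Fin 3 → ℝ) F.2.1 = _) ∧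
    (F.2.1.insertNth (sideLevel F.1.1 F.2.1 F.2.2) y : Fin 3 → ℝ) ∈ frontier Ω ↔ _
  rw [insertNth_mem_Icc_box, Fin.insertNth_apply_same]
  have h := F.1.1.lower_le_upper F.2.1
  have : F.1.1.lower F.2.1 ≤ sideLevel F.1.1 F.2.1 F.2.2 ∧
      sideLevel F.1.1 F.2.1 F.2.2 ≤ F.1.1.upper F.2.1 := by
    cases F.2.2 <;> simp [sideLevel, h]
  tauto

theorem dom_inl_subset {T : BoxMesh Ω} (F : InteriorFace T) (s : Bool) :
    Face.dom (.inl F : Face T) ⊆ BoxIntegral.Box.Icc ((F.elem s).1.face F.1.2.2) :=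
  fun _ hy => (insertNth_mem_Icc_box.mp (mem_dom_inl.mp hy s)).2

theorem Face.isCompact_dom {T : BoxMesh Ω} (F : Face T) : IsCompact F.dom := by
  have hc : Continuous fun y : Fin 2 → ℝ => (F.axis.insertNth F.level y : Fin 3 → ℝ) :=
    continuous_const.finInsertNth F.axis continuous_id
  have hclosed : IsClosed F.carrier := by
    rcases F with F | F
    · exact isClosed_frontier.inter isClosed_frontier
    · refine IsClosed.inter (IsClosed.and ?_ ?_) isClosed_frontier
      · exact F.1.1.isCompact_Icc.isClosed
      · exact isClosed_eq (continuous_apply _) continuous_const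
  have hd : IsClosed F.dom := hclosed.preimage hc
  rcases F with F | F
  · exact (F.1.1.1.face F.1.2.2).isCompact_Icc.of_isClosed_subset hd (dom_inl_subset F true)
  · exact (F.1.1.face F.2.1).isCompact_Icc.of_isClosed_subset hd fun y hy => (mem_dom_inr.mp hy).1

theorem BoxMesh.ae_isGeneric (T : BoxMesh Ω) :
    ∀ᵐ y : Fin 2 → ℝ, ∀ (i : Fin 3) (t : ℝ), T.IsGeneric i (i.insertNth t y : Fin 3 → ℝ) := by
  have h : ∀ᵐ y : Fin 2 → ℝ, ∀ j, y j ∉ T.gridValues := by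
    rw [ae_all_iff]
    intro j
    have := (Measure.quasiMeasurePreserving_eval (fun _ : Fin 2 => (volume : Measure ℝ)) j).ae
      (p := fun t => t ∉ T.gridValues) (T.finite_gridValues.countable.ae_notMem volume)
    exact this
  filter_upwards [h] with y hy i t j hj
  obtain ⟨k, rfl⟩ := Fin.exists_succAbove_eq hj
  simpa using hy k

open scoped Classical in
/-- A side of an element is, up to a null set, the disjoint union of its boundary part and the
interior faces that it contains. This is where `int (closure Ω) = Ω` enters. -/
theorem integral_side (hΩ : interior (closure Ω) = Ω) (T : BoxMesh Ω) (K : T.elems) (i : Fin 3)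
    (s : Bool) {g : (Fin 2 → ℝ) → ℝ} (hg : Continuous g) :
    ∫ y in BoxIntegral.Box.Icc (K.1.face i), g y =
      (∑ F : InteriorFace T, if F.elem s = K ∧ F.1.2.2 = i
        then ∫ y in Face.dom (.inl F : Face T), g y else 0)
      + ∫ y in Face.dom (.inr (K, i, s) : Face T), g y := by
  have hm : ∀ F : Face T, MeasurableSet F.dom := fun F => F.isCompact_dom.measurableSet
  have hint : ∀ F : Face T, Integrable (F.dom.indicator g) := fun F =>
    (integrable_indicator_iff (hm F)).mpr (hg.continuousOn.integrableOn_compact F.isCompact_dom)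
  have e1 : ∀ F : InteriorFace T, (if F.elem s = K ∧ F.1.2.2 = i
        then ∫ y in Face.dom (.inl F : Face T), g y else 0)
      = ∫ y, if F.elem s = K ∧ F.1.2.2 = i then (Face.dom (.inl F : Face T)).indicator g y
          else 0 := by
    intro F
    split_ifs
    · rw [integral_indicator (hm _)]
    · simp
  rw [Finset.sum_congr rfl fun F _ => e1 F, ← integral_indicator (hm _),
    ← integral_indicator (K.1.face i).isCompact_Icc.measurableSet, ← integral_finsetSum,
    ← integral_add]
  rotate_left
  · refine integrable_finsetSum _ fun F _ => ?_
    split_ifs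
    · exact hint _
    · simp
  · exact hint _
  · intro F _
    split_ifs
    · exact hint _
    · simp
  refine integral_congr_ae ?_
  filter_upwards [T.ae_isGeneric] with y hy
  by_cases hyK : y ∈ BoxIntegral.Box.Icc (K.1.face i)
  swap
  · rw [Set.indicator_of_notMem hyK, Set.indicator_of_notMem fun h => hyK (mem_dom_inr.mp h).1,
      add_zero, Finset.sum_eq_zero]
    rintro F -
    split_ifs with h
    · obtain ⟨rfl, rfl⟩ := h
      exact Set.indicator_of_notMem (fun h => hyK (dom_inl_subset F s h)) _
    · rfl
  rw [Set.indicator_of_mem hyK]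
  set x : Fin 3 → ℝ := i.insertNth (sideLevel K.1 i s) y with hxdef
  have hx : T.IsGeneric i x := hy i _
  have hxi : x i = sideLevel K.1 i s := by simp [hxdef]
  have hxK : x ∈ BoxIntegral.Box.Icc K.1 := by
    refine insertNth_mem_Icc_box.mpr ⟨?_, hyK⟩
    have := K.1.lower_le_upper i
    cases s <;> simp [sideLevel, this]
  have hdom : ∀ F : InteriorFace T, F.elem s = K → F.1.2.2 = i →
      y ∈ Face.dom (.inl F : Face T) → x ∈ BoxIntegral.Box.Icc (F.elem !s).1 := by
    rintro F rfl rfl h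
    have := mem_dom_inl.mp h (!s)
    rwa [F.level_eq s] at this
  by_cases hxΩ : x ∈ frontier Ω
  · rw [Set.indicator_of_mem (mem_dom_inr.mpr ⟨hyK, hxΩ⟩), Finset.sum_eq_zero, zero_add]
    rintro F -
    split_ifs with h
    · refine Set.indicator_of_notMem (fun hF => ?_) _
      have hxL := hdom F h.1 h.2 hF
      have hN := F.isNeighbour s
      rw [h.1, h.2] at hN
      have hopen : IsOpen Ω := hΩ ▸ isOpen_interior
      rw [hopen.frontier_eq] at hxΩ
      refine hxΩ.2 ?_
      cases s
      · exact mem_of_isInteriorFace hΩ T (F.elem true).2 K.2 hN hx hxL hxK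
      · exact mem_of_isInteriorFace hΩ T K.2 (F.elem false).2 hN hx hxK hxL
    · rfl
  · obtain ⟨L, hL, hN, hxL⟩ := exists_neighbour hΩ T K.2 hx hxK hxi hxΩ
    obtain ⟨F, rfl, rfl, hFL⟩ : ∃ F : InteriorFace T, F.elem s = K ∧ F.1.2.2 = i ∧
        F.elem (!s) = ⟨L, hL⟩ := by
      cases s
      · exact ⟨⟨(⟨L, hL⟩, K, i), hN⟩, rfl, rfl, rfl⟩
      · exact ⟨⟨(K, ⟨L, hL⟩, i), hN⟩, rfl, rfl, rfl⟩
    have hF : y ∈ Face.dom (.inl F : Face T) := by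
      rw [mem_dom_inl, F.level_eq s]
      intro s'
      rcases Bool.eq_or_eq_not s' s with rfl | rfl
      · exact hxK
      · rw [hFL]; exact hxL
    rw [Set.indicator_of_notMem fun h => hxΩ (mem_dom_inr.mp h).2, add_zero,
      Finset.sum_eq_single_of_mem F (Finset.mem_univ _), if_pos ⟨rfl, rfl⟩,
      Set.indicator_of_mem hF]
    intro F' _ hne
    split_ifs with h
    · refine Set.indicator_of_notMem (fun hF' => hne ?_) _
      have hxL' := hdom F' h.1 h.2 hF'
      have hN' := F'.isNeighbour s
      rw [h.1, h.2] at hN'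
      have hLL : F'.elem (!s) = F.elem (!s) := by
        by_contra hne
        rw [hFL] at hne
        have h1 := hx.separated (F'.elem !s).2 hL (fun h => hne (Subtype.ext h)) hxL' hxL
        have l1 := L.lower_lt_upper F.1.2.2
        have l2 := (F'.elem !s).1.lower_lt_upper F.1.2.2
        cases s
        · have a := hN.1
          have b := hN'.1
          rcases h1 with h1 | h1 <;> linarith
        · have a := hN.1
          have b := hN'.1
          rcases h1 with h1 | h1 <;> linarith
      apply Subtype.ext
      cases s
      · exact Prod.ext hLL (Prod.ext h.1 h.2)
      · exact Prod.ext h.1 (Prod.ext hLL h.2)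
    · rfl

/-- A family of functions, one for each side of each element, summed up on each face over the
elements adjacent to it. -/
def faceSum {T : BoxMesh Ω} (g : T.elems → Fin 3 → Bool → (Fin 3 → ℝ) → ℝ) (F : Face T)
    (x : Fin 3 → ℝ) : ℝ :=
  match F with
  | .inl F => ∑ s, g (F.elem s) F.1.2.2 s x
  | .inr F => g F.1 F.2.1 F.2.2 x

open scoped Classical in
theorem sum_face {T : BoxMesh Ω} (φ : Face T → ℝ) :
    ∑ F, φ F = ∑ F : InteriorFace T, φ (.inl F) + ∑ F : BoundaryFace T, φ (.inr F) := by
  rw [← Fintype.sum_sum_type]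

/-- Reordering of a sum over all faces as a sum over the sides of all elements. -/
theorem integralFaces_faceSum (hΩ : interior (closure Ω) = Ω) (T : BoxMesh Ω)
    (g : T.elems → Fin 3 → Bool → (Fin 3 → ℝ) → ℝ) (hg : ∀ K i s, Continuous (g K i s)) :
    integralFaces T (faceSum g) = ∑ K : T.elems, ∑ i, ∑ s,
      ∫ y in BoxIntegral.Box.Icc (K.1.face i), g K i s (i.insertNth (sideLevel K.1 i s) y) := by
  classical
  have hc : ∀ K i s t, Continuous fun y : Fin 2 → ℝ => g K i s (i.insertNth t y : Fin 3 → ℝ) :=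
    fun K i s t => (hg K i s).comp (continuous_const.finInsertNth i continuous_id)
  simp only [fun K i s => integral_side hΩ T K i s (hc K i s (sideLevel K.1 i s)),
    Finset.sum_add_distrib]
  rw [integralFaces, sum_face]
  congr 1
  · have h1 : ∀ F : InteriorFace T,
        ∫ y in {y : Fin 2 → ℝ | (Face.axis (.inl F : Face T)).insertNth
            (Face.level (.inl F : Face T)) y ∈ Face.carrier (.inl F : Face T)},
          faceSum g (.inl F) ((Face.axis (.inl F : Face T)).insertNth
            (Face.level (.inl F : Face T)) y)
        = ∑ s, ∫ y in Face.dom (.inl F : Face T), g (F.elem s) F.1.2.2 s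
            (F.1.2.2.insertNth (sideLevel (F.elem s).1 F.1.2.2 s) y) := by
      intro F
      change ∫ y in Face.dom (.inl F : Face T), ∑ s, g (F.elem s) F.1.2.2 s
            (F.1.2.2.insertNth (Face.level (.inl F : Face T)) y) = _
      rw [integral_finsetSum _ fun s _ =>
        (hc _ _ _ _).continuousOn.integrableOn_compact (Face.isCompact_dom _)]
      exact Finset.sum_congr rfl fun s _ => by rw [F.level_eq s]
    rw [Finset.sum_congr rfl fun F _ => h1 F]
    have h2 : ∀ ψ : T.elems → Fin 3 → Bool → InteriorFace T → ℝ,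
        ∑ K, ∑ i, ∑ s, ∑ F, ψ K i s F = ∑ F, ∑ s, ∑ K, ∑ i, ψ K i s F := by
      intro ψ
      calc _ = ∑ K, ∑ i, ∑ F, ∑ s, ψ K i s F :=
            Finset.sum_congr rfl fun K _ => Finset.sum_congr rfl fun i _ => Finset.sum_comm
        _ = ∑ K, ∑ F, ∑ i, ∑ s, ψ K i s F := Finset.sum_congr rfl fun K _ => Finset.sum_comm
        _ = ∑ F, ∑ K, ∑ i, ∑ s, ψ K i s F := Finset.sum_comm
        _ = ∑ F, ∑ K, ∑ s, ∑ i, ψ K i s F :=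
            Finset.sum_congr rfl fun F _ => Finset.sum_congr rfl fun K _ => Finset.sum_comm
        _ = _ := Finset.sum_congr rfl fun F _ => Finset.sum_comm
    rw [h2]
    refine Finset.sum_congr rfl fun F _ => Finset.sum_congr rfl fun s _ => ?_
    rw [Finset.sum_eq_single_of_mem (F.elem s) (Finset.mem_univ _),
      Finset.sum_eq_single_of_mem F.1.2.2 (Finset.mem_univ _), if_pos ⟨rfl, rfl⟩]
    · intro i _ hi
      rw [if_neg fun h => hi h.2.symm]
    · intro K _ hK
      exact Finset.sum_eq_zero fun i _ => if_neg fun h => hK h.1.symm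
  · simp only [BoundaryFace, Fintype.sum_prod_type]
    rfl

variable {T : BoxMesh Ω} {k : ℕ}

/-! ### Integrals of piecewise polynomials -/

theorem integrableOn_eval (p : MvPolynomial (Fin 3) ℝ) (K : BoxIntegral.Box (Fin 3)) :
    IntegrableOn (fun x => MvPolynomial.eval x p) (BoxIntegral.Box.Icc K) :=
  p.continuous_eval.continuousOn.integrableOn_compact K.isCompact_Icc

/-- The integral over `Ω` of a piecewise polynomial, as a linear form; it is the sum of the
integrals over the closed elements (see `integral_fn`). -/
noncomputable def brokenIntegral (T : BoxMesh Ω) : Broken T →ₗ[ℝ] ℝ where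
  toFun g := ∑ K : T.elems, ∫ x in BoxIntegral.Box.Icc K.1, MvPolynomial.eval x (g K)
  map_add' g h := by
    rw [← Finset.sum_add_distrib]
    refine Finset.sum_congr rfl fun K _ => ?_
    rw [← integral_add (integrableOn_eval _ _) (integrableOn_eval _ _)]
    simp
  map_smul' c g := by
    rw [RingHom.id_apply, smul_eq_mul, Finset.mul_sum]
    refine Finset.sum_congr rfl fun K _ => ?_
    rw [← integral_const_mul]
    simp [MvPolynomial.smul_eval]

theorem brokenIntegral_apply (g : Broken T) : brokenIntegral T g =
    ∑ K : T.elems, ∫ x in BoxIntegral.Box.Icc K.1, MvPolynomial.eval x (g K) := rfl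

theorem Broken.fn_of_mem (g : Broken T) {K : T.elems} {x : Fin 3 → ℝ}
    (hx : x ∈ BoxIntegral.Box.Ioo K.1) : g.fn x = MvPolynomial.eval x (g K) := by
  rw [Broken.fn, Finset.sum_eq_single_of_mem K (Finset.mem_univ _), Set.indicator_of_mem hx]
  intro L _ hL
  refine Set.indicator_of_notMem (fun h => ?_) _
  exact Set.disjoint_left.mp (T.disjoint L.1 L.2 K.1 K.2 fun h => hL (Subtype.ext h)) h hx

theorem Broken.fn_of_forall_notMem (g : Broken T) {x : Fin 3 → ℝ}
    (hx : ∀ K : T.elems, x ∉ BoxIntegral.Box.Ioo K.1) : g.fn x = 0 :=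
  Finset.sum_eq_zero fun K _ => Set.indicator_of_notMem (hx K) _

theorem Broken.fn_mul (g h : Broken T) (x : Fin 3 → ℝ) : (g * h).fn x = g.fn x * h.fn x := by
  by_cases hx : ∃ K : T.elems, x ∈ BoxIntegral.Box.Ioo K.1
  · obtain ⟨K, hK⟩ := hx
    simp [Broken.fn_of_mem _ hK]
  · push Not at hx
    simp [Broken.fn_of_forall_notMem _ hx]

theorem Broken.fn_add (g h : Broken T) (x : Fin 3 → ℝ) : (g + h).fn x = g.fn x + h.fn x := by
  by_cases hx : ∃ K : T.elems, x ∈ BoxIntegral.Box.Ioo K.1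
  · obtain ⟨K, hK⟩ := hx
    simp [Broken.fn_of_mem _ hK]
  · push Not at hx
    simp [Broken.fn_of_forall_notMem _ hx]

theorem Broken.fn_smul (c : ℝ) (g : Broken T) (x : Fin 3 → ℝ) : (c • g).fn x = c * g.fn x := by
  by_cases hx : ∃ K : T.elems, x ∈ BoxIntegral.Box.Ioo K.1
  · obtain ⟨K, hK⟩ := hx
    simp [Broken.fn_of_mem _ hK, MvPolynomial.smul_eval]
  · push Not at hx
    simp [Broken.fn_of_forall_notMem _ hx]

theorem Broken.fn_sum {ι : Type*} (s : Finset ι) (g : ι → Broken T) (x : Fin 3 → ℝ) :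
    Broken.fn (∑ i ∈ s, g i) x = ∑ i ∈ s, (g i).fn x := by
  classical
  induction s using Finset.induction_on with
  | empty => simpa using Broken.fn_smul 0 (0 : Broken T) x
  | insert a s ha ih => rw [Finset.sum_insert ha, Finset.sum_insert ha, Broken.fn_add, ih]

theorem integral_fn (g : Broken T) : ∫ x in Ω, g.fn x = brokenIntegral T g := by
  have hm : ∀ K : T.elems, MeasurableSet (BoxIntegral.Box.Ioo K.1) := fun K =>
    (isOpen_Ioo_box K.1).measurableSet
  have hi : ∀ K : T.elems, IntegrableOn (fun x => MvPolynomial.eval x (g K))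
      (BoxIntegral.Box.Ioo K.1) := fun K =>
    (integrableOn_eval _ _).mono_set K.1.Ioo_subset_Icc
  simp only [Broken.fn]
  rw [integral_finsetSum _ fun K _ => ((integrable_indicator_iff (hm K)).mpr (hi K)).restrict,
    brokenIntegral_apply]
  refine Finset.sum_congr rfl fun K _ => ?_
  rw [setIntegral_indicator (hm K), Set.inter_eq_right.mpr (T.subset K.1 K.2)]
  exact setIntegral_congr_set (BoxIntegral.Box.Ioo_ae_eq_Icc K.1)

theorem BoxMesh.isBounded (T : BoxMesh Ω) : Bornology.IsBounded Ω := by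
  refine Bornology.IsBounded.subset ?_ subset_closure
  rw [T.cover]
  exact (Bornology.isBounded_biUnion T.elems.finite_toSet).mpr fun K _ => K.isBounded_Icc

/-- The elements cover `Ω` up to a null set. -/
theorem BoxMesh.ae_mem_elem (T : BoxMesh Ω) :
    ∀ᵐ x : Fin 3 → ℝ, x ∈ Ω → ∃ K : T.elems, x ∈ BoxIntegral.Box.Ioo K.1 := by
  have h : ∀ᵐ x : Fin 3 → ℝ, ∀ j, x j ∉ T.gridValues := by
    rw [ae_all_iff]
    intro j
    have := (Measure.quasiMeasurePreserving_eval (fun _ : Fin 3 => (volume : Measure ℝ)) j).ae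
      (p := fun t => t ∉ T.gridValues) (T.finite_gridValues.countable.ae_notMem volume)
    exact this
  filter_upwards [h] with x hx hxΩ
  have hcl := subset_closure hxΩ
  rw [T.cover] at hcl
  simp only [Set.mem_iUnion] at hcl
  obtain ⟨K, hK, hxK⟩ := hcl
  refine ⟨⟨K, hK⟩, mem_Ioo_box.mpr fun j => ?_⟩
  obtain ⟨i, hi⟩ := exists_ne j
  exact BoxMesh.IsGeneric.lt (i := i) (fun j _ => hx j) hK hxK hi.symm

theorem brokenIntegral_one (hΩ : IsOpen Ω) : brokenIntegral T 1 = volume.real Ω := by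
  rw [← integral_fn, ← setIntegral_one_eq_measureReal]
  refine setIntegral_congr_ae hΩ.measurableSet ?_
  filter_upwards [T.ae_mem_elem] with x hx hxΩ
  obtain ⟨K, hK⟩ := hx hxΩ
  simp [Broken.fn_of_mem _ hK]

theorem measureReal_pos (T : BoxMesh Ω) (hΩ : IsOpen Ω) (hne : Ω.Nonempty) :
    0 < volume.real Ω :=
  ENNReal.toReal_pos (hΩ.measure_pos _ hne).ne' T.isBounded.measure_lt_top.ne

/-- The sign of the outward normal on the upper and the lower sides. -/
def sideSign (s : Bool) : ℝ := if s then 1 else -1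

theorem sideNormal_apply (i : Fin 3) (s : Bool) (j : Fin 3) :
    sideNormal i s j = if j = i then sideSign s else 0 := by
  cases s <;> simp [sideNormal, sideSign, Pi.single_apply]
  split_ifs <;> simp

/-- The divergence theorem on an element, for a polynomial vector field parallel to `e_i`. -/
theorem integral_pderiv (K : BoxIntegral.Box (Fin 3)) (i : Fin 3) (p : MvPolynomial (Fin 3) ℝ) :
    ∫ x in BoxIntegral.Box.Icc K, MvPolynomial.eval x (MvPolynomial.pderiv i p) =
      ∑ s, ∫ y in BoxIntegral.Box.Icc (K.face i),
        sideSign s * MvPolynomial.eval (i.insertNth (sideLevel K i s) y : Fin 3 → ℝ) p := by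
  have h := integral_divergence_of_hasFDerivAt_off_countable' K.lower K.upper
    K.lower_le_upper
    (fun j x => if j = i then MvPolynomial.eval x p else 0)
    (fun j x => if j = i then ∑ l, MvPolynomial.eval x (MvPolynomial.pderiv l p) •
        (ContinuousLinearMap.proj l : (Fin 3 → ℝ) →L[ℝ] ℝ) else 0) ∅ Set.countable_empty
    (fun j => by
      by_cases hj : j = i
      · simpa [hj] using p.continuous_eval.continuousOn
      · simpa [hj] using continuousOn_const)
    (fun x _ j => by
      by_cases hj : j = i
      · simpa [hj] using hasFDerivAt_eval p x
      · simpa [hj] using hasFDerivAt_const (0 : ℝ) x)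
  have e : ∀ x : Fin 3 → ℝ, (∑ j, (if j = i then
      ∑ l, MvPolynomial.eval x (MvPolynomial.pderiv l p) •
        (ContinuousLinearMap.proj l : (Fin 3 → ℝ) →L[ℝ] ℝ) else 0) (Pi.single j 1)) =
      MvPolynomial.eval x (MvPolynomial.pderiv i p) := by
    intro x
    rw [Finset.sum_eq_single_of_mem i (Finset.mem_univ _)]
    · simp [Pi.single_apply]
    · intro j _ hj; simp [hj]
  simp only [e] at h
  have h' := h (integrableOn_eval _ K)
  rw [BoxIntegral.Box.Icc_def, h', Finset.sum_eq_single_of_mem i (Finset.mem_univ _)]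
  · simp only [if_true, Fintype.sum_bool, integral_const_mul, sideSign, sideLevel]
    simp only [Bool.false_eq_true, if_false]
    rw [one_mul, neg_one_mul, sub_eq_add_neg]
    rfl
  · intro j _ hj; simp [hj]

/-! ### Sums of face integrals -/

theorem integrableOn_dom (F : Face T) {g : (Fin 3 → ℝ) → ℝ} (hg : Continuous g) :
    IntegrableOn (fun y => g (F.axis.insertNth F.level y)) F.dom :=
  (hg.comp (continuous_const.finInsertNth F.axis continuous_id)).continuousOn.integrableOn_compact
    F.isCompact_dom

theorem integralFaces_add {g h : Face T → (Fin 3 → ℝ) → ℝ} (hg : ∀ F, Continuous (g F))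
    (hh : ∀ F, Continuous (h F)) :
    integralFaces T (fun F x => g F x + h F x) = integralFaces T g + integralFaces T h := by
  simp only [integralFaces]
  rw [← Finset.sum_add_distrib]
  exact Finset.sum_congr rfl fun F _ =>
    integral_add (integrableOn_dom F (hg F)) (integrableOn_dom F (hh F))

theorem integralFaces_const_mul (c : ℝ) (g : Face T → (Fin 3 → ℝ) → ℝ) :
    integralFaces T (fun F x => c * g F x) = c * integralFaces T g := by
  simp only [integralFaces, Finset.mul_sum]
  exact Finset.sum_congr rfl fun F _ => integral_const_mul _ _

theorem integralFaces_sub {g h : Face T → (Fin 3 → ℝ) → ℝ} (hg : ∀ F, Continuous (g F))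
    (hh : ∀ F, Continuous (h F)) :
    integralFaces T (fun F x => g F x - h F x) = integralFaces T g - integralFaces T h := by
  simp only [integralFaces]
  rw [← Finset.sum_sub_distrib]
  exact Finset.sum_congr rfl fun F _ =>
    integral_sub (integrableOn_dom F (hg F)) (integrableOn_dom F (hh F))

theorem integralFaces_mono {g h : Face T → (Fin 3 → ℝ) → ℝ} (hg : ∀ F, Continuous (g F))
    (hh : ∀ F, Continuous (h F)) (hle : ∀ F x, g F x ≤ h F x) :
    integralFaces T g ≤ integralFaces T h :=
  Finset.sum_le_sum fun F _ => integral_mono (integrableOn_dom F (hg F))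
    (integrableOn_dom F (hh F)) fun _ => hle F _

theorem integralFaces_nonneg {g : Face T → (Fin 3 → ℝ) → ℝ} (hg : ∀ F x, 0 ≤ g F x) :
    0 ≤ integralFaces T g :=
  Finset.sum_nonneg fun F _ => integral_nonneg fun _ => hg F _

theorem ae_eq_zero_of_integralFaces_eq_zero {g : Face T → (Fin 3 → ℝ) → ℝ}
    (hg : ∀ F, Continuous (g F)) (h0 : ∀ F x, 0 ≤ g F x) (h : integralFaces T g = 0)
    (F : Face T) : ∀ᵐ y ∂volume.restrict F.dom, g F (F.axis.insertNth F.level y) = 0 := by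
  have h1 := (Finset.sum_eq_zero_iff_of_nonneg fun F _ => integral_nonneg fun _ => h0 F _).mp h
    F (Finset.mem_univ F)
  exact (integral_eq_zero_iff_of_nonneg (fun _ => h0 F _) (integrableOn_dom F (hg F))).mp h1

theorem continuous_avg (g : Broken T) (F : Face T) : Continuous fun x => F.avg g x := by
  rcases F with F | F
  · exact ((MvPolynomial.continuous_eval _).add (MvPolynomial.continuous_eval _)).div_const _
  · exact MvPolynomial.continuous_eval _

theorem continuous_jump (g : Broken T) (j : Fin 3) (F : Face T) :
    Continuous fun x => F.jump g j x := by
  rcases F with F | F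
  · exact ((MvPolynomial.continuous_eval _).mul_const _).add
      ((MvPolynomial.continuous_eval _).mul_const _)
  · exact (MvPolynomial.continuous_eval _).mul_const _

theorem continuous_faceSum {g : T.elems → Fin 3 → Bool → (Fin 3 → ℝ) → ℝ}
    (hg : ∀ K i s, Continuous (g K i s)) (F : Face T) : Continuous (faceSum g F) := by
  rcases F with F | F
  · exact continuous_finsetSum _ fun s _ => hg _ _ _
  · exact hg _ _ _

theorem avg_add (g h : Broken T) (x : Fin 3 → ℝ) (F : Face T) :
    F.avg (g + h) x = F.avg g x + F.avg h x := by
  rcases F with F | F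
  · simp [Face.avg]; ring
  · simp [Face.avg]

theorem avg_smul (c : ℝ) (g : Broken T) (x : Fin 3 → ℝ) (F : Face T) :
    F.avg (c • g) x = c * F.avg g x := by
  rcases F with F | F <;> simp [Face.avg, MvPolynomial.smul_eval]; ring

theorem jump_add (g h : Broken T) (j : Fin 3) (x : Fin 3 → ℝ) (F : Face T) :
    F.jump (g + h) j x = F.jump g j x + F.jump h j x := by
  rcases F with F | F <;> simp [Face.jump] <;> ring

theorem jump_smul (c : ℝ) (g : Broken T) (j : Fin 3) (x : Fin 3 → ℝ) (F : Face T) :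
    F.jump (c • g) j x = c * F.jump g j x := by
  rcases F with F | F <;> simp [Face.jump, MvPolynomial.smul_eval] <;> ring

/-- On the faces, only the component of the jump in the direction of the normal is non-zero. -/
theorem jump_eq_zero (g : Broken T) {j : Fin 3} (x : Fin 3 → ℝ) {F : Face T} (hj : j ≠ F.axis) :
    F.jump g j x = 0 := by
  rcases F with F | F
  · have : j ≠ F.1.2.2 := hj
    simp [Face.jump, sideNormal_apply, this]
  · have : j ≠ F.2.1 := hj
    simp [Face.jump, sideNormal_apply, this]

/-! ### The form `B_h` -/

theorem formB_def (v : Velocity T k) (q : FullPressure T k) :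
    formB v q = -brokenIntegral T (q.toBroken * v.div)
      + integralFaces T (fun F x => F.avg q.toBroken x * ∑ j, F.jump (v.comp j) j x) := by
  rw [formB, ← integral_fn]
  simp only [Broken.fn_mul]

theorem sum_jump_eq_faceSum (v : Velocity T k) (F : Face T) (x : Fin 3 → ℝ) :
    ∑ j, F.jump (v.comp j) j x =
      faceSum (fun K i s x => sideSign s * MvPolynomial.eval x (v K i).1) F x := by
  rcases F with F | F
  · simp [faceSum, InteriorFace.elem, Face.jump, sideNormal_apply, Finset.sum_add_distrib,
      Velocity.comp, mul_comm]
  · simp [faceSum, Face.jump, sideNormal_apply, Velocity.comp, mul_comm]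

/-- The product of the jump of the pressure and the average of the normal component of the velocity
on an interior face, and `0` on a boundary face. -/
noncomputable def pressureJumpTerm (v : Velocity T k) (q : FullPressure T k) (F : Face T)
    (x : Fin 3 → ℝ) : ℝ :=
  match F with
  | .inl F => (MvPolynomial.eval x (q (F.elem false)).1 - MvPolynomial.eval x (q (F.elem true)).1)
      * ∑ s, MvPolynomial.eval x (v (F.elem s) F.1.2.2).1 / 2
  | .inr _ => 0

/-- Elementwise integration by parts in `B_h`. -/
theorem formB_eq (hΩ : interior (closure Ω) = Ω) (v : Velocity T k) (q : FullPressure T k) :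
    formB v q = brokenIntegral T (fun K => ∑ i, MvPolynomial.pderiv i (q K).1 * (v K i).1)
      + integralFaces T (pressureJumpTerm v q) := by
  have h1 : q.toBroken * v.div = (fun K => ∑ i, MvPolynomial.pderiv i ((q K).1 * (v K i).1))
      - (fun K => ∑ i, MvPolynomial.pderiv i (q K).1 * (v K i).1) := by
    funext K
    simp only [Pi.mul_apply, Pi.sub_apply, FullPressure.toBroken, Velocity.div,
      MvPolynomial.pderiv_mul, Finset.sum_add_distrib, Finset.mul_sum]
    ring
  have h2 : brokenIntegral T (fun K => ∑ i, MvPolynomial.pderiv i ((q K).1 * (v K i).1)) =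
      integralFaces T (faceSum fun K i s x =>
        sideSign s * MvPolynomial.eval x ((q K).1 * (v K i).1)) := by
    rw [integralFaces_faceSum hΩ T _ (by
      exact fun K i s => continuous_const.mul (MvPolynomial.continuous_eval _)),
      brokenIntegral_apply]
    refine Finset.sum_congr rfl fun K _ => ?_
    simp only [map_sum]
    rw [integral_finsetSum _ fun i _ => integrableOn_eval _ _]
    exact Finset.sum_congr rfl fun i _ => integral_pderiv _ _ _
  rw [formB_def, h1, map_sub, h2]
  have hc1 : ∀ F : Face T, Continuous (faceSum (fun (K : T.elems) i s x =>
      sideSign s * MvPolynomial.eval x ((q K).1 * (v K i).1)) F) :=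
    continuous_faceSum fun K i s => continuous_const.mul (MvPolynomial.continuous_eval _)
  have hc2 : ∀ F : Face T, Continuous fun x =>
      F.avg q.toBroken x * ∑ j, F.jump (v.comp j) j x := fun F =>
    (continuous_avg _ F).mul (continuous_finsetSum _ fun j _ => continuous_jump _ _ F)
  have h3 : pressureJumpTerm v q = fun F x => F.avg q.toBroken x * ∑ j, F.jump (v.comp j) j x
      - faceSum (fun K i s x => sideSign s * MvPolynomial.eval x ((q K).1 * (v K i).1)) F x := by
    funext F x
    rw [sum_jump_eq_faceSum]
    rcases F with F | F
    · simp [pressureJumpTerm, faceSum, Face.avg, InteriorFace.elem, sideSign,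
        FullPressure.toBroken]
      ring
    · simp [pressureJumpTerm, faceSum, Face.avg, sideSign, FullPressure.toBroken]
  rw [h3, integralFaces_sub hc2 hc1]
  ring

/-! ### Positive definiteness of `A_h` -/

/-- Fubini's theorem on a box, with the integral over the lines parallel to `e_i` inside. -/
theorem setIntegral_box_eq (K : BoxIntegral.Box (Fin 3)) (i : Fin 3) {f : (Fin 3 → ℝ) → ℝ}
    (hf : Continuous f) :
    IntegrableOn (fun y : Fin 2 → ℝ => ∫ t in Set.Icc (K.lower i) (K.upper i),
        f (i.insertNth t y)) (BoxIntegral.Box.Icc (K.face i)) ∧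
    ∫ x in BoxIntegral.Box.Icc K, f x = ∫ y in BoxIntegral.Box.Icc (K.face i),
      ∫ t in Set.Icc (K.lower i) (K.upper i), f (i.insertNth t y) := by
  set e : ℝ × (Fin 2 → ℝ) ≃ᵐ (Fin 3 → ℝ) := (MeasurableEquiv.piFinSuccAbove (fun _ => ℝ) i).symm
  have hem : MeasurePreserving e :=
    (volume_preserving_piFinSuccAbove (fun _ : Fin 3 => ℝ) i).symm _
  have heK : e ⁻¹' BoxIntegral.Box.Icc K =
      Set.Icc (K.lower i) (K.upper i) ×ˢ BoxIntegral.Box.Icc (K.face i) := by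
    ext ⟨t, y⟩
    exact insertNth_mem_Icc_box
  have hint : IntegrableOn (fun z => f (e z))
      (Set.Icc (K.lower i) (K.upper i) ×ˢ BoxIntegral.Box.Icc (K.face i)) := by
    rw [← heK]
    exact (hem.integrableOn_comp_preimage e.measurableEmbedding).mpr
      (hf.continuousOn.integrableOn_compact K.isCompact_Icc)
  rw [← hem.setIntegral_preimage_emb e.measurableEmbedding, heK]
  rw [IntegrableOn, Measure.volume_eq_prod, ← Measure.prod_restrict] at hint
  rw [Measure.volume_eq_prod, ← Measure.prod_restrict]
  exact ⟨hint.integral_prod_right, integral_prod_symm _ hint⟩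

/-- The discrete trace inequality on an axi-parallel hexahedron. -/
theorem integral_side_sq_le (K : BoxIntegral.Box (Fin 3)) (i : Fin 3) (s : Bool)
    (p : MvPolynomial (Fin 3) ℝ) {n : ℕ} (hp : p.degreeOf i ≤ n) :
    (K.upper i - K.lower i) * ∫ y in BoxIntegral.Box.Icc (K.face i),
        MvPolynomial.eval (i.insertNth (sideLevel K i s) y : Fin 3 → ℝ) p ^ 2
      ≤ (n + 1) ^ 2 * ∫ x in BoxIntegral.Box.Icc K, MvPolynomial.eval x p ^ 2 := by
  have hc : Continuous fun x : Fin 3 → ℝ => MvPolynomial.eval x p ^ 2 :=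
    p.continuous_eval.pow 2
  obtain ⟨h1, h2⟩ := setIntegral_box_eq K i hc
  rw [h2, ← integral_const_mul, ← integral_const_mul]
  refine integral_mono ?_ (h1.const_mul _) fun y => ?_
  · refine Integrable.const_mul ?_ _
    exact (hc.comp (continuous_const.finInsertNth i continuous_id)).continuousOn
      |>.integrableOn_compact (K.face i).isCompact_Icc
  · obtain ⟨P, hP, hPe⟩ := exists_eval_insertNth p i y
    simp only [← hPe]
    exact sq_eval_endpoint_le n P (hP.trans hp) (K.lower_lt_upper i) s

theorem integralFaces_sum {ι : Type*} (s : Finset ι) {g : ι → Face T → (Fin 3 → ℝ) → ℝ}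
    (hg : ∀ a F, Continuous (g a F)) :
    integralFaces T (fun F x => ∑ a ∈ s, g a F x) = ∑ a ∈ s, integralFaces T (g a) := by
  simp only [integralFaces]
  rw [Finset.sum_comm]
  exact Finset.sum_congr rfl fun F _ => integral_finsetSum _ fun a _ => integrableOn_dom F (hg a F)

/-- The Frobenius product `∇_h u : ∇_h v` of two elementwise gradients. -/
noncomputable def gradDot (u v : Velocity T k) : Broken T :=
  ∑ i, ∑ j, u.grad i j * v.grad i j

/-- The sum of the consistency terms of `A_h` on a face. -/
noncomputable def fluxTerm (θ : ℝ) (u v : Velocity T k) (F : Face T) (x : Fin 3 → ℝ) : ℝ :=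
  ∑ i, ∑ j, (θ * (F.avg (v.grad i j) x * F.jump (u.comp i) j x)
        + F.avg (u.grad i j) x * F.jump (v.comp i) j x)

/-- The integrand of the jump penalty, without the parameter `γ`. -/
noncomputable def penaltyTerm (u v : Velocity T k) (F : Face T) (x : Fin 3 → ℝ) : ℝ :=
  F.size⁻¹ * (k : ℝ) ^ 2 * ∑ i, ∑ j, F.jump (u.comp i) j x * F.jump (v.comp i) j x

theorem continuous_fluxTerm (θ : ℝ) (u v : Velocity T k) (F : Face T) :
    Continuous (fluxTerm θ u v F) :=
  continuous_finsetSum _ fun _ _ => continuous_finsetSum _ fun _ _ =>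
    (continuous_const.mul ((continuous_avg _ F).mul (continuous_jump _ _ F))).add
      ((continuous_avg _ F).mul (continuous_jump _ _ F))

theorem continuous_penaltyTerm (u v : Velocity T k) (F : Face T) :
    Continuous (penaltyTerm u v F) :=
  continuous_const.mul <| continuous_finsetSum _ fun _ _ => continuous_finsetSum _ fun _ _ =>
    (continuous_jump _ _ F).mul (continuous_jump _ _ F)

theorem formA_def (γ θ : ℝ) (u v : Velocity T k) : formA γ θ u v =
    brokenIntegral T (gradDot u v) - integralFaces T (fluxTerm θ u v)
      + γ * integralFaces T (penaltyTerm u v) := by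
  rw [formA, ← integral_fn, ← integralFaces_const_mul]
  simp only [gradDot, Broken.fn_sum, Broken.fn_mul]
  congr 2
  funext F x
  simp only [penaltyTerm]
  ring

theorem Face.size_pos (F : Face T) : 0 < F.size := by
  rcases F with F | F
  · exact lt_min (sub_pos.mpr (F.1.1.1.lower_lt_upper _)) (sub_pos.mpr (F.1.2.1.1.lower_lt_upper _))
  · exact sub_pos.mpr (F.1.1.lower_lt_upper _)

theorem penaltyTerm_nonneg (u : Velocity T k) (F : Face T) (x : Fin 3 → ℝ) :
    0 ≤ penaltyTerm u u F x :=
  mul_nonneg (mul_nonneg (inv_nonneg.mpr F.size_pos.le) (sq_nonneg _))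
    (Finset.sum_nonneg fun _ _ => Finset.sum_nonneg fun _ _ => mul_self_nonneg _)

/-- The square of a piecewise polynomial on the sides perpendicular to `e_j`, with the weight
`h^⊥ / k²` of the trace inequality. -/
noncomputable def weightedSq (k : ℕ) (g : Broken T) (j : Fin 3) (K : T.elems) (i : Fin 3) (_ : Bool)
    (x : Fin 3 → ℝ) : ℝ :=
  if j = i then (K.1.upper i - K.1.lower i) / (k : ℝ) ^ 2 * MvPolynomial.eval x (g K) ^ 2 else 0

theorem continuous_weightedSq (g : Broken T) (j : Fin 3) (K : T.elems) (i : Fin 3) (s : Bool) :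
    Continuous (weightedSq k g j K i s) := by
  unfold weightedSq
  split_ifs
  · exact continuous_const.mul ((MvPolynomial.continuous_eval _).pow 2)
  · exact continuous_const

theorem weightedSq_nonneg (g : Broken T) (j : Fin 3) (K : T.elems) (i : Fin 3) (s : Bool)
    (x : Fin 3 → ℝ) : 0 ≤ weightedSq k g j K i s x := by
  unfold weightedSq
  have := sub_pos.mpr (K.1.lower_lt_upper i)
  split_ifs <;> positivity

/-- The trace inequality summed over all elements: each element has two sides perpendicular to
`e_j`, and each of them contributes `(k + 1)² / k² ≤ 4`. -/
theorem integralFaces_weightedSq_le (hΩ : interior (closure Ω) = Ω) (hk : 1 ≤ k) (g : Broken T)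
    (j : Fin 3) (hg : ∀ K, (g K).degreeOf j ≤ k) :
    integralFaces T (faceSum (weightedSq k g j)) ≤ 8 * brokenIntegral T (g * g) := by
  rw [integralFaces_faceSum hΩ T _ fun K i s => continuous_weightedSq g j K i s,
    brokenIntegral_apply, Finset.mul_sum]
  refine Finset.sum_le_sum fun K _ => ?_
  rw [Finset.sum_eq_single_of_mem j (Finset.mem_univ _)]
  swap
  · intro i _ hi
    simp [weightedSq, hi.symm]
  have hkpos : (1 : ℝ) ≤ k := by exact_mod_cast hk
  have hI : 0 ≤ ∫ x in BoxIntegral.Box.Icc K.1, MvPolynomial.eval x (g K) ^ 2 :=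
    integral_nonneg fun x => sq_nonneg _
  have hs : ∀ s : Bool, (∫ y in BoxIntegral.Box.Icc (K.1.face j),
      weightedSq k g j K j s (j.insertNth (sideLevel K.1 j s) y))
      ≤ 4 * ∫ x in BoxIntegral.Box.Icc K.1, MvPolynomial.eval x (g K) ^ 2 := by
    intro s
    simp only [weightedSq, if_true]
    rw [integral_const_mul]
    have h := integral_side_sq_le K.1 j s (g K) (hg K)
    have hk4 : ((k : ℝ) + 1) ^ 2 ≤ 4 * k ^ 2 := by nlinarith
    rw [div_mul_eq_mul_div, div_le_iff₀ (by positivity)]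
    calc _ ≤ _ := h
      _ ≤ 4 * (k : ℝ) ^ 2 * ∫ x in BoxIntegral.Box.Icc K.1, MvPolynomial.eval x (g K) ^ 2 :=
        mul_le_mul_of_nonneg_right hk4 hI
      _ = _ := by ring
  rw [Fintype.sum_bool]
  have e : ∀ x, MvPolynomial.eval x ((g * g) K) = MvPolynomial.eval x (g K) ^ 2 := fun x => by
    simp [sq]
  simp only [e]
  linarith [hs true, hs false]

/-- On an interior face, the extent of the face is at most those of both elements, so each of the
two values in the average is controlled with the weight of its own element. -/
theorem size_mul_avg_sq_le (hk : 1 ≤ k) (g : Broken T) (F : Face T) (x : Fin 3 → ℝ) :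
    F.size / (k : ℝ) ^ 2 * F.avg g x ^ 2 ≤ faceSum (weightedSq k g F.axis) F x := by
  have hkpos : (1 : ℝ) ≤ k := by exact_mod_cast hk
  have hk2 : (0 : ℝ) < (k : ℝ) ^ 2 := by positivity
  rcases F with F | F
  · simp only [faceSum, weightedSq, Face.axis, if_true, Fintype.sum_bool, InteriorFace.elem,
      Face.avg, Face.size, Bool.false_eq_true, if_false]
    set a := MvPolynomial.eval x (g F.1.1)
    set b := MvPolynomial.eval x (g F.1.2.1)
    have h1 := min_le_left (F.1.1.1.upper F.1.2.2 - F.1.1.1.lower F.1.2.2)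
      (F.1.2.1.1.upper F.1.2.2 - F.1.2.1.1.lower F.1.2.2)
    have h2 := min_le_right (F.1.1.1.upper F.1.2.2 - F.1.1.1.lower F.1.2.2)
      (F.1.2.1.1.upper F.1.2.2 - F.1.2.1.1.lower F.1.2.2)
    have h0 : 0 < min (F.1.1.1.upper F.1.2.2 - F.1.1.1.lower F.1.2.2)
      (F.1.2.1.1.upper F.1.2.2 - F.1.2.1.1.lower F.1.2.2) := Face.size_pos (.inl F : Face T)
    set m := min (F.1.1.1.upper F.1.2.2 - F.1.1.1.lower F.1.2.2)
      (F.1.2.1.1.upper F.1.2.2 - F.1.2.1.1.lower F.1.2.2)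
    have h3 : ((a + b) / 2) ^ 2 ≤ a ^ 2 + b ^ 2 := by
      nlinarith [sq_nonneg (a - b), sq_nonneg (a + b)]
    calc m / (k : ℝ) ^ 2 * ((a + b) / 2) ^ 2
        ≤ m / (k : ℝ) ^ 2 * (a ^ 2 + b ^ 2) := by gcongr
      _ = m / (k : ℝ) ^ 2 * a ^ 2 + m / (k : ℝ) ^ 2 * b ^ 2 := by ring
      _ ≤ _ := by gcongr
  · simp [faceSum, weightedSq, Face.axis, Face.avg, Face.size]

/-- Young's inequality for one consistency term. The weight `1 / 16` is half the reciprocal of the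
constant `8` in `integralFaces_weightedSq_le`, so that half of the gradient term remains. -/
theorem flux_le (hk : 1 ≤ k) {θ : ℝ} (hθ : θ ∈ Set.Icc (-1 : ℝ) 1) (g w : Broken T) (j : Fin 3)
    (F : Face T) (x : Fin 3 → ℝ) :
    (θ + 1) * (F.avg g x * F.jump w j x) ≤ 1 / 16 * faceSum (weightedSq k g j) F x
      + 16 * (F.size⁻¹ * (k : ℝ) ^ 2 * (F.jump w j x * F.jump w j x)) := by
  by_cases hj : j = F.axis
  · subst hj
    have hkpos : (1 : ℝ) ≤ k := by exact_mod_cast hk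
    have hF := F.size_pos
    refine le_trans ?_ (add_le_add (mul_le_mul_of_nonneg_left (size_mul_avg_sq_le hk g F x)
      (by norm_num)) le_rfl)
    set a := F.avg g x
    set b := F.jump w F.axis x
    set r := F.size / (k : ℝ) ^ 2 with hr
    have hrpos : 0 < r := by positivity
    have hr' : F.size⁻¹ * (k : ℝ) ^ 2 = r⁻¹ := by rw [hr, inv_div]; ring
    rw [hr']
    have h1 : (θ + 1) * (a * b) ≤ 2 * |a * b| := by
      calc (θ + 1) * (a * b) ≤ (θ + 1) * |a * b| :=
            mul_le_mul_of_nonneg_left (le_abs_self _) (by linarith [hθ.1])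
        _ ≤ 2 * |a * b| := mul_le_mul_of_nonneg_right (by linarith [hθ.2]) (abs_nonneg _)
    refine h1.trans ?_
    have h2 : 1 / 16 * (r * a ^ 2) + 16 * (r⁻¹ * (b * b))
        = 1 / (16 * r) * ((r * |a|) ^ 2 + (16 * |b|) ^ 2) := by
      rw [mul_pow, mul_pow, sq_abs, sq_abs]
      field_simp
    have h3 : 2 * |a * b| = 1 / (16 * r) * (2 * (r * |a|) * (16 * |b|)) := by
      rw [abs_mul]; field_simp
    rw [h2, h3]
    exact mul_le_mul_of_nonneg_left (two_mul_le_add_sq _ _) (by positivity)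
  · rw [jump_eq_zero w x hj]
    have : 0 ≤ faceSum (weightedSq k g j) F x := by
      rcases F with F | F
      · exact Finset.sum_nonneg fun s _ => weightedSq_nonneg _ _ _ _ _ _
      · exact weightedSq_nonneg g j F.1 F.2.1 F.2.2 x
    simp only [mul_zero, add_zero]
    linarith

theorem degreeOf_grad_le (u : Velocity T k) (i j : Fin 3) (K : T.elems) :
    (u.grad i j K).degreeOf j ≤ k :=
  ((degreeOf_pderiv_le _ j j).trans (Nat.sub_le _ _)).trans
    (mem_restrictDegree_iff_degreeOf.mp (u K i).2 j)

theorem integralFaces_fluxTerm_le (hΩ : interior (closure Ω) = Ω) (hk : 1 ≤ k) {θ : ℝ}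
    (hθ : θ ∈ Set.Icc (-1 : ℝ) 1) (u : Velocity T k) :
    integralFaces T (fluxTerm θ u u) ≤ 1 / 2 * brokenIntegral T (gradDot u u)
      + 16 * integralFaces T (penaltyTerm u u) := by
  have hcW : ∀ i j (F : Face T), Continuous (faceSum (weightedSq k (u.grad i j) j) F) :=
    fun i j F => continuous_faceSum (fun K a s => continuous_weightedSq _ _ _ _ _) F
  have hcS : ∀ F : Face T, Continuous fun x =>
      1 / 16 * ∑ i, ∑ j, faceSum (weightedSq k (u.grad i j) j) F x := fun F =>
    continuous_const.mul <| continuous_finsetSum _ fun i _ => continuous_finsetSum _ fun j _ =>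
      hcW i j F
  have hcP : ∀ F : Face T, Continuous fun x => 16 * penaltyTerm u u F x := fun F =>
    continuous_const.mul (continuous_penaltyTerm u u F)
  have h1 : integralFaces T (fluxTerm θ u u) ≤ integralFaces T (fun F x =>
      1 / 16 * ∑ i, ∑ j, faceSum (weightedSq k (u.grad i j) j) F x
        + 16 * penaltyTerm u u F x) := by
    refine integralFaces_mono (continuous_fluxTerm θ u u) (fun F => (hcS F).add (hcP F))
      fun F x => ?_
    simp only [fluxTerm, penaltyTerm, Finset.mul_sum, ← Finset.sum_add_distrib]
    refine Finset.sum_le_sum fun i _ => Finset.sum_le_sum fun j _ => ?_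
    calc _ = (θ + 1) * (F.avg (u.grad i j) x * F.jump (u.comp i) j x) := by ring
      _ ≤ _ := flux_le hk hθ _ _ _ _ _
  rw [integralFaces_add hcS hcP, integralFaces_const_mul, integralFaces_const_mul,
    integralFaces_sum _ fun i F => continuous_finsetSum _ fun j _ => hcW i j F] at h1
  have h2 : ∑ i, integralFaces T (fun F x => ∑ j, faceSum (weightedSq k (u.grad i j) j) F x)
      ≤ 8 * brokenIntegral T (gradDot u u) := by
    rw [gradDot, map_sum, Finset.mul_sum]
    refine Finset.sum_le_sum fun i _ => ?_
    rw [integralFaces_sum _ fun j F => hcW i j F, map_sum, Finset.mul_sum]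
    exact Finset.sum_le_sum fun j _ =>
      integralFaces_weightedSq_le hΩ hk _ j fun K => degreeOf_grad_le u i j K
  linarith

/-- Coercivity of `A_h`. -/
theorem le_formA_self (hΩ : interior (closure Ω) = Ω) (hk : 1 ≤ k) {θ γ : ℝ}
    (hθ : θ ∈ Set.Icc (-1 : ℝ) 1) (hγ : 17 ≤ γ) (u : Velocity T k) :
    1 / 2 * brokenIntegral T (gradDot u u) + integralFaces T (penaltyTerm u u)
      ≤ formA γ θ u u := by
  rw [formA_def]
  have h1 := integralFaces_fluxTerm_le hΩ hk hθ u
  have h2 : 0 ≤ integralFaces T (penaltyTerm u u) := integralFaces_nonneg (penaltyTerm_nonneg u)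
  nlinarith

/-- A polynomial vanishes if its square has zero integral over a box, for a weight that is positive
in the interior. -/
theorem eq_zero_of_integral_weight_eq_zero {K : BoxIntegral.Box (Fin 3)}
    {p b : MvPolynomial (Fin 3) ℝ} (hb : ∀ x ∈ BoxIntegral.Box.Ioo K, 0 < MvPolynomial.eval x b)
    (h : ∫ x in BoxIntegral.Box.Icc K, MvPolynomial.eval x (p * (p * b)) = 0) : p = 0 := by
  rw [← setIntegral_congr_set (BoxIntegral.Box.Ioo_ae_eq_Icc K)] at h
  have hm := (isOpen_Ioo_box K).measurableSet
  have hnn : 0 ≤ᵐ[volume.restrict (BoxIntegral.Box.Ioo K)]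
      fun x => MvPolynomial.eval x (p * (p * b)) := by
    refine ae_restrict_of_forall_mem hm fun x hx => ?_
    simp only [Pi.zero_apply, map_mul, ← mul_assoc]
    exact mul_nonneg (mul_self_nonneg _) (hb x hx).le
  have h0 := (integral_eq_zero_iff_of_nonneg_ae hnn
    ((integrableOn_eval _ K).mono_set K.Ioo_subset_Icc)).mp h
  have heq := Measure.eqOn_open_of_ae_eq h0 (isOpen_Ioo_box K)
    (MvPolynomial.continuous_eval _).continuousOn continuousOn_const
  refine MvPolynomial.funext_set (fun i => Set.Ioo (K.lower i) (K.upper i))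
    (fun i => Set.Ioo_infinite (K.lower_lt_upper i)) fun x hx => ?_
  have := heq (x := x) hx
  simp only [map_mul, Pi.zero_apply, mul_eq_zero, (hb x hx).ne', or_false, or_self] at this
  simpa using this

theorem brokenIntegral_nonneg {g : Broken T}
    (hg : ∀ K : T.elems, ∀ x ∈ BoxIntegral.Box.Ioo K.1, 0 ≤ MvPolynomial.eval x (g K)) :
    0 ≤ brokenIntegral T g := by
  rw [brokenIntegral_apply]
  refine Finset.sum_nonneg fun K _ => ?_
  rw [← setIntegral_congr_set (BoxIntegral.Box.Ioo_ae_eq_Icc K.1)]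
  exact setIntegral_nonneg (isOpen_Ioo_box K.1).measurableSet (hg K)

/-- Weighted `L²` definiteness on the broken polynomial space. -/
theorem eq_zero_of_brokenIntegral_eq_zero {p b : Fin 3 → Broken T}
    (hb : ∀ i (K : T.elems), ∀ x ∈ BoxIntegral.Box.Ioo K.1, 0 < MvPolynomial.eval x (b i K))
    (h : brokenIntegral T (∑ i, p i * (p i * b i)) = 0) (i : Fin 3) : p i = 0 := by
  have hnn : ∀ i (K : T.elems), ∀ x ∈ BoxIntegral.Box.Ioo K.1,
      0 ≤ MvPolynomial.eval x ((p i * (p i * b i)) K) := by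
    intro i K x hx
    simp only [Pi.mul_apply, map_mul, ← mul_assoc]
    exact mul_nonneg (mul_self_nonneg _) (hb i K x hx).le
  rw [map_sum, Finset.sum_eq_zero_iff_of_nonneg fun i _ => brokenIntegral_nonneg (hnn i)] at h
  have h1 := h i (Finset.mem_univ i)
  rw [brokenIntegral_apply, Finset.sum_eq_zero_iff_of_nonneg] at h1
  · funext K
    exact eq_zero_of_integral_weight_eq_zero (hb i K) (h1 K (Finset.mem_univ K))
  · intro K _
    rw [← setIntegral_congr_set (BoxIntegral.Box.Ioo_ae_eq_Icc K.1)]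
    exact setIntegral_nonneg (isOpen_Ioo_box K.1).measurableSet (hnn i K)

theorem volume_face_pos (K : BoxIntegral.Box (Fin 3)) (i : Fin 3) :
    0 < volume.real (BoxIntegral.Box.Icc (K.face i)) := by
  rw [BoxIntegral.Box.Icc_def, measureReal_def, Real.volume_Icc_pi_toReal (K.face i).lower_le_upper]
  exact Finset.prod_pos fun j _ => sub_pos.mpr ((K.face i).lower_lt_upper j)

/-- `A_h` is positive definite. With zero energy, a velocity is piecewise constant without jumps,
and it vanishes in the elements one after the other, in decreasing order of their upper levels in a
fixed direction. -/
theorem eq_zero_of_formA_self_nonpos (hΩ : interior (closure Ω) = Ω) (hk : 1 ≤ k) {θ γ : ℝ}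
    (hθ : θ ∈ Set.Icc (-1 : ℝ) 1) (hγ : 17 ≤ γ) (u : Velocity T k) (hu : formA γ θ u u ≤ 0) :
    u = 0 := by
  classical
  have hco := le_formA_self hΩ hk hθ hγ u
  have hg0 : ∀ i j, 0 ≤ brokenIntegral T (u.grad i j * u.grad i j) := fun i j =>
    brokenIntegral_nonneg fun K x _ => by
      simp only [Pi.mul_apply, map_mul]; exact mul_self_nonneg _
  have hG : brokenIntegral T (gradDot u u) = ∑ i, ∑ j,
      brokenIntegral T (u.grad i j * u.grad i j) := by simp [gradDot, map_sum]
  have hGnn : 0 ≤ brokenIntegral T (gradDot u u) := by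
    rw [hG]; exact Finset.sum_nonneg fun i _ => Finset.sum_nonneg fun j _ => hg0 i j
  have hPnn : 0 ≤ integralFaces T (penaltyTerm u u) := integralFaces_nonneg (penaltyTerm_nonneg u)
  have hG0 : brokenIntegral T (gradDot u u) = 0 := by linarith
  have hP0 : integralFaces T (penaltyTerm u u) = 0 := by linarith
  have hgrad : ∀ i j, u.grad i j = 0 := by
    intro i
    refine eq_zero_of_brokenIntegral_eq_zero (p := fun j => u.grad i j) (b := fun _ => 1)
      (fun _ _ _ _ => by simp) ?_
    rw [hG, Finset.sum_eq_zero_iff_of_nonneg fun i _ => Finset.sum_nonneg fun j _ => hg0 i j] at hG0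
    simpa [map_sum] using hG0 i (Finset.mem_univ i)
  have hconst : ∀ (K : T.elems) i, ∃ c : ℝ, (u K i).1 = MvPolynomial.C c := fun K i =>
    ⟨_, eq_C_of_pderiv_eq_zero fun j => congrFun (hgrad i j) K⟩
  have hjump : ∀ (F : Face T) i, ∀ᵐ y ∂volume.restrict F.dom,
      F.jump (u.comp i) F.axis (F.axis.insertNth F.level y) = 0 := by
    intro F i
    have hkpos : (0 : ℝ) < k := by exact_mod_cast hk
    filter_upwards [ae_eq_zero_of_integralFaces_eq_zero (continuous_penaltyTerm u u)
      (penaltyTerm_nonneg u) hP0 F] with y hy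
    have hF := F.size_pos
    rw [penaltyTerm, mul_eq_zero, or_iff_right (by positivity),
      Finset.sum_eq_zero_iff_of_nonneg fun _ _ => Finset.sum_nonneg fun _ _ => mul_self_nonneg _]
      at hy
    have h1 := hy i (Finset.mem_univ i)
    rw [Finset.sum_eq_zero_iff_of_nonneg fun _ _ => mul_self_nonneg _] at h1
    exact mul_self_eq_zero.mp (h1 F.axis (Finset.mem_univ _))
  by_contra hne
  obtain ⟨K₀, hK₀⟩ := Function.ne_iff.mp hne
  obtain ⟨K, hK, hmax⟩ := Finset.exists_max_image
    ((Finset.univ : Finset T.elems).filter fun K => u K ≠ 0) (fun K => K.1.upper 0)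
    ⟨K₀, by simpa using hK₀⟩
  simp only [Finset.mem_filter, Finset.mem_univ, true_and] at hK hmax
  obtain ⟨i, hi⟩ := Function.ne_iff.mp hK
  obtain ⟨c, hc⟩ := hconst K i
  have hc0 : c ≠ 0 := by
    rintro rfl
    exact hi (Subtype.ext (by simpa using hc))
  have hside := integral_side hΩ T K 0 true (g := fun _ => c ^ 2) continuous_const
  rw [Finset.sum_eq_zero, zero_add] at hside
  · have hb : ∫ y in Face.dom (.inr (K, 0, true) : Face T), c ^ 2 = 0 := by
      rw [← integral_zero (Fin 2 → ℝ) ℝ]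
      refine integral_congr_ae ?_
      filter_upwards [hjump (.inr (K, 0, true)) i] with y hy
      simp only [Face.jump, Face.axis, Velocity.comp, hc, MvPolynomial.eval_C,
        sideNormal_apply, sideSign, if_true, mul_one] at hy
      simp [hy]
    rw [hb, setIntegral_const, smul_eq_mul, mul_eq_zero] at hside
    rcases hside with h | h
    · exact (volume_face_pos K.1 0).ne' h
    · exact hc0 (by simpa using h)
  · rintro F -
    split_ifs with h
    · obtain ⟨rfl, hax⟩ := h
      have hL : u (F.elem false) = 0 := by
        by_contra hL
        have h1 := hmax _ hL
        have h2 := (F.elem false).1.lower_lt_upper 0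
        have h3 := F.2.1
        rw [hax] at h3
        have h4 : (F.elem true).1.upper 0 = (F.elem false).1.lower 0 := h3
        linarith
      rw [← integral_zero (Fin 2 → ℝ) ℝ]
      refine integral_congr_ae ?_
      filter_upwards [hjump (.inl F) i] with y hy
      have hcK : (u F.1.1 i).1 = MvPolynomial.C c := hc
      have hcL : (u F.1.2.1 i).1 = 0 := by
        have : u F.1.2.1 = 0 := hL
        simp [this]
      simp only [Face.jump, Face.axis, Velocity.comp, hcK, hcL, MvPolynomial.eval_C,
        sideNormal_apply, sideSign, if_true, mul_one, map_zero, zero_mul, add_zero] at hy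
      simp [hy]
    · rfl

/-! ### Connectivity of the mesh through its interior faces -/

/-- Moving one coordinate within `Ω`, with the other coordinates generic, only crosses the relative
interiors of faces. -/
theorem exists_mem_update {S : Set T.elems}
    (hS : ∀ F : InteriorFace T, F.elem true ∈ S ↔ F.elem false ∈ S) {x : Fin 3 → ℝ} {i : Fin 3}
    {t : ℝ} (hx : T.IsGeneric i x) (hseg : ∀ r ∈ Set.uIcc (x i) t, Function.update x i r ∈ Ω)
    (hxS : ∃ K ∈ S, x ∈ BoxIntegral.Box.Icc K.1) :
    ∃ K ∈ S, Function.update x i t ∈ BoxIntegral.Box.Icc K.1 := by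
  classical
  have hc : Continuous fun r : ℝ => Function.update x i r := by fun_prop
  let A : Set T.elems → Set ℝ := fun R =>
    ⋃ K ∈ R, (fun r : ℝ => Function.update x i r) ⁻¹' BoxIntegral.Box.Icc K.1
  have hA : ∀ R, IsClosed (A R) := fun R =>
    R.toFinite.isClosed_biUnion fun K _ => K.1.isCompact_Icc.isClosed.preimage hc
  have hcov : Set.uIcc (x i) t ⊆ A S ∪ A Sᶜ := by
    intro r hr
    have h := subset_closure (hseg r hr)
    rw [T.cover] at h
    simp only [Set.mem_iUnion] at h
    obtain ⟨K, hK, hrK⟩ := h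
    by_cases hKS : (⟨K, hK⟩ : T.elems) ∈ S
    · exact Or.inl (Set.mem_biUnion hKS hrK)
    · exact Or.inr (Set.mem_biUnion (show (⟨K, hK⟩ : T.elems) ∈ Sᶜ from hKS) hrK)
  by_contra hcon
  have htA : t ∈ A Sᶜ := by
    rcases hcov Set.right_mem_uIcc with h | h
    · simp only [A, Set.mem_iUnion, Set.mem_preimage] at h
      obtain ⟨K, hK, h⟩ := h
      exact absurd ⟨K, hK, h⟩ hcon
    · exact h
  have hxA : x i ∈ A S := by
    obtain ⟨K, hK, h⟩ := hxS
    exact Set.mem_biUnion hK (by simpa using h)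
  obtain ⟨r, -, hrS, hrS'⟩ := isPreconnected_closed_iff.mp
    (isPreconnected_uIcc (a := x i) (b := t)) (A S) (A Sᶜ) (hA _) (hA _) hcov
    ⟨_, Set.left_mem_uIcc, hxA⟩ ⟨_, Set.right_mem_uIcc, htA⟩
  simp only [A, Set.mem_iUnion, Set.mem_preimage] at hrS hrS'
  obtain ⟨K, hK, hrK⟩ := hrS
  obtain ⟨L, hL, hrL⟩ := hrS'
  have hz : T.IsGeneric i (Function.update x i r) := fun j hj => by simpa [hj] using hx j hj
  have hne : K ≠ L := fun h => hL (h ▸ hK)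
  have hpos : ∀ j, j ≠ i → max (K.1.lower j) (L.1.lower j) < min (K.1.upper j) (L.1.upper j) := by
    intro j hj
    have h1 := hz.lt K.2 hrK hj
    have h2 := hz.lt L.2 hrL hj
    exact (max_lt h1.1 h2.1).trans (lt_min h1.2 h2.2)
  have h1 := mem_Icc_box.mp hrK i
  have h2 := mem_Icc_box.mp hrL i
  rcases hz.separated K.2 L.2 (fun h => hne (Subtype.ext h)) hrK hrL with h | h
  · exact hL ((hS ⟨(K, L, i), by linarith, hpos⟩).mp hK)
  · refine hL ((hS ⟨(L, K, i), by linarith, fun j hj => ?_⟩).mpr hK)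
    rw [max_comm, min_comm]
    exact hpos j hj

/-- Near every point of the closure of an element there is a point of the element none of whose
coordinates is a grid value. -/
theorem exists_generic_near {K : BoxIntegral.Box (Fin 3)} {x : Fin 3 → ℝ}
    (hx : x ∈ BoxIntegral.Box.Icc K) {ε : ℝ} (hε : 0 < ε) :
    ∃ a ∈ BoxIntegral.Box.Icc K, (∀ j, a j ∉ T.gridValues) ∧ ∀ j, |a j - x j| < ε := by
  have h : ∀ j, ∃ t, (K.lower j ≤ t ∧ t ≤ K.upper j) ∧ t ∉ T.gridValues ∧ |t - x j| < ε := by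
    intro j
    have hj := mem_Icc_box.mp hx j
    have hlt : max (K.lower j) (x j - ε) < min (K.upper j) (x j + ε) := by
      refine max_lt (lt_min (K.lower_lt_upper j) ?_) (lt_min ?_ ?_) <;> linarith
    obtain ⟨t, ht, htg⟩ := (Set.Ioo_infinite hlt).exists_notMem_finite T.finite_gridValues
    obtain ⟨h1, h2⟩ := ht
    rw [max_lt_iff] at h1
    rw [lt_min_iff] at h2
    exact ⟨t, ⟨h1.1.le, h2.1.le⟩, htg, abs_lt.mpr ⟨by linarith, by linarith⟩⟩
  choose a ha using h
  exact ⟨a, mem_Icc_box.mpr fun j => (ha j).1, fun j => (ha j).2.1, fun j => (ha j).2.2⟩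

/-- In a connected domain, any two elements are linked by a chain of interior faces. -/
theorem eq_univ_of_face_invariant (hΩ : IsOpen Ω) (hconn : IsPreconnected Ω) {S : Set T.elems}
    (hS : ∀ F : InteriorFace T, F.elem true ∈ S ↔ F.elem false ∈ S) (hne : S.Nonempty) :
    S = Set.univ := by
  let A : Set T.elems → Set (Fin 3 → ℝ) := fun R => ⋃ K ∈ R, BoxIntegral.Box.Icc K.1
  have hA : ∀ R, IsClosed (A R) := fun R =>
    R.toFinite.isClosed_biUnion fun K _ => K.1.isCompact_Icc.isClosed
  have hcov : Ω ⊆ A S ∪ A Sᶜ := by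
    intro x hx
    have h := subset_closure hx
    rw [T.cover] at h
    simp only [Set.mem_iUnion] at h
    obtain ⟨K, hK, hxK⟩ := h
    by_cases hKS : (⟨K, hK⟩ : T.elems) ∈ S
    · exact Or.inl (Set.mem_biUnion hKS hxK)
    · exact Or.inr (Set.mem_biUnion (show (⟨K, hK⟩ : T.elems) ∈ Sᶜ from hKS) hxK)
  have hmeet : ∀ R : Set T.elems, R.Nonempty → (Ω ∩ A R).Nonempty := by
    rintro R ⟨K, hK⟩
    have hmid : (fun j => (K.1.lower j + K.1.upper j) / 2) ∈ BoxIntegral.Box.Ioo K.1 :=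
      mem_Ioo_box.mpr fun j => by
        have := K.1.lower_lt_upper j
        constructor <;> linarith
    exact ⟨_, T.subset K.1 K.2 hmid, Set.mem_biUnion hK (K.1.Ioo_subset_Icc hmid)⟩
  by_contra hSu
  have hSc : Sᶜ.Nonempty := Set.nonempty_compl.mpr hSu
  obtain ⟨x, hxΩ, hxS, hxS'⟩ := isPreconnected_closed_iff.mp hconn (A S) (A Sᶜ) (hA _) (hA _) hcov
    (hmeet _ hne) (hmeet _ hSc)
  simp only [A, Set.mem_iUnion] at hxS hxS'
  obtain ⟨K, hK, hxK⟩ := hxS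
  obtain ⟨L, hL, hxL⟩ := hxS'
  obtain ⟨ε, hε, hball⟩ := Metric.isOpen_iff.mp hΩ x hxΩ
  have hbox : ∀ z : Fin 3 → ℝ, (∀ j, |z j - x j| < ε) → z ∈ Ω := fun z hz =>
    hball (by rw [Metric.mem_ball, dist_pi_lt_iff hε]; exact hz)
  obtain ⟨a, haK, hag, hax⟩ := exists_generic_near (T := T) hxK hε
  obtain ⟨b, hbL, hbg, hbx⟩ := exists_generic_near (T := T) hxL hε
  have step : ∀ (z : Fin 3 → ℝ) (i : Fin 3), (∀ j, z j ∉ T.gridValues) → (∀ j, |z j - x j| < ε) →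
      (∃ M ∈ S, z ∈ BoxIntegral.Box.Icc M.1) →
      (∀ j, Function.update z i (b i) j ∉ T.gridValues) ∧
      (∀ j, |Function.update z i (b i) j - x j| < ε) ∧
      (∃ M ∈ S, Function.update z i (b i) ∈ BoxIntegral.Box.Icc M.1) := by
    intro z i hzg hzx hzS
    have hupd : ∀ r, |r - x i| < ε → ∀ j, |Function.update z i r j - x j| < ε := by
      intro r hr j
      rcases eq_or_ne j i with rfl | hj
      · simpa using hr
      · simpa [hj] using hzx j
    refine ⟨fun j => ?_, hupd _ (hbx i), exists_mem_update hS (fun j _ => hzg j) ?_ hzS⟩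
    · rcases eq_or_ne j i with rfl | hj
      · simpa using hbg j
      · simpa [hj] using hzg j
    · intro r hr
      refine hbox _ (hupd r ?_)
      have h1 := abs_lt.mp (hzx i)
      have h2 := abs_lt.mp (hbx i)
      rw [Set.mem_uIcc] at hr
      rw [abs_lt]
      rcases hr with hr | hr <;> constructor <;> linarith
  -- go from `a` to `b` along the three coordinate directions
  obtain ⟨g0, x0, s0⟩ := step a 0 hag hax ⟨K, hK, haK⟩
  obtain ⟨g1, x1, s1⟩ := step _ 1 g0 x0 s0
  obtain ⟨-, -, M, hM, hbM⟩ := step _ 2 g1 x1 s1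
  have hb : Function.update (Function.update (Function.update a 0 (b 0)) 1 (b 1)) 2 (b 2) = b := by
    funext j
    fin_cases j <;> simp
  rw [hb] at hbM
  -- the generic point `b` lies in the interior of a single element
  have hbin : ∀ N : T.elems, b ∈ BoxIntegral.Box.Icc N.1 → b ∈ BoxIntegral.Box.Ioo N.1 := by
    intro N hN
    refine mem_Ioo_box.mpr fun j => ?_
    obtain ⟨i, hi⟩ := exists_ne j
    exact BoxMesh.IsGeneric.lt (i := i) (fun j _ => hbg j) N.2 hN hi.symm
  have hML : M ≠ L := fun h => hL (h ▸ hM)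
  exact Set.disjoint_left.mp (T.disjoint M.1 M.2 L.1 L.2 fun h => hML (Subtype.ext h))
    (hbin M hbM) (hbin L hbL)

/-! ### The kernel of `B_h` -/

/-- The constant pressure. -/
noncomputable def constPressure (T : BoxMesh Ω) (k : ℕ) (c : ℝ) : FullPressure T k := fun _ =>
  ⟨MvPolynomial.C c, mem_restrictDegree_iff_degreeOf.mpr fun i => by simp⟩

theorem toBroken_constPressure (c : ℝ) : (constPressure T k c).toBroken = c • 1 := by
  funext K
  simp [constPressure, FullPressure.toBroken, MvPolynomial.smul_eq_C_mul]

/-- Constants are in the kernel of `B_h`. -/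
theorem formB_constPressure (hΩ : interior (closure Ω) = Ω) (v : Velocity T k) (c : ℝ) :
    formB v (constPressure T k c) = 0 := by
  have h1 : pressureJumpTerm v (constPressure T k c) = fun _ _ => 0 := by
    funext F x
    rcases F with F | F <;> simp [pressureJumpTerm, constPressure]
  rw [formB_eq hΩ, h1]
  have h2 : (fun K : T.elems => ∑ i, MvPolynomial.pderiv i (constPressure T k c K).1 * (v K i).1)
      = 0 := by
    funext K
    simp [constPressure]
  rw [h2, map_zero, zero_add]
  simp [integralFaces]

/-- The polynomial `(x_i - lower_i) (upper_i - x_i)`, positive in `K` and zero on the two sides of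
`K` perpendicular to `e_i`. -/
noncomputable def bubble (K : BoxIntegral.Box (Fin 3)) (i : Fin 3) : MvPolynomial (Fin 3) ℝ :=
  (MvPolynomial.X i - MvPolynomial.C (K.lower i)) * (MvPolynomial.C (K.upper i) - MvPolynomial.X i)

theorem eval_bubble (K : BoxIntegral.Box (Fin 3)) (i : Fin 3) (x : Fin 3 → ℝ) :
    MvPolynomial.eval x (bubble K i) = (x i - K.lower i) * (K.upper i - x i) := by
  simp [bubble]

theorem degreeOf_bubble_le (K : BoxIntegral.Box (Fin 3)) (i j : Fin 3) :
    (bubble K i).degreeOf j ≤ if j = i then 2 else 0 := by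
  have hX : (MvPolynomial.X i : MvPolynomial (Fin 3) ℝ).degreeOf j ≤ if j = i then 1 else 0 := by
    rw [MvPolynomial.degreeOf_X]
  have h1 := (MvPolynomial.degreeOf_sub_le j (MvPolynomial.X i : MvPolynomial (Fin 3) ℝ)
    (MvPolynomial.C (K.lower i)))
  have h2 := (MvPolynomial.degreeOf_sub_le j (MvPolynomial.C (K.upper i))
    (MvPolynomial.X i : MvPolynomial (Fin 3) ℝ))
  have h3 := MvPolynomial.degreeOf_mul_le j
    (MvPolynomial.X i - MvPolynomial.C (K.lower i) : MvPolynomial (Fin 3) ℝ)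
    (MvPolynomial.C (K.upper i) - MvPolynomial.X i)
  rw [MvPolynomial.degreeOf_C] at h1 h2
  unfold bubble
  split_ifs at hX ⊢ <;> omega

/-- Multiplying `∂_i q` by the bubble raises the degree in `x_i` by one only. -/
theorem pderiv_mul_bubble_mem {q : MvPolynomial (Fin 3) ℝ}
    (hq : q ∈ MvPolynomial.restrictDegree (Fin 3) ℝ (k - 1)) (K : BoxIntegral.Box (Fin 3))
    (i : Fin 3) :
    MvPolynomial.pderiv i q * bubble K i ∈ MvPolynomial.restrictDegree (Fin 3) ℝ k := by
  rw [mem_restrictDegree_iff_degreeOf] at hq ⊢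
  intro j
  by_cases h0 : MvPolynomial.pderiv i q = 0
  · simp [h0]
  have hi : q.degreeOf i ≠ 0 := by
    intro h
    refine h0 (MvPolynomial.pderiv_eq_zero_of_notMem_vars ?_)
    rw [MvPolynomial.mem_vars_iff_degreeOf_ne_zero, not_not, h]
  have h1 := MvPolynomial.degreeOf_mul_le j (MvPolynomial.pderiv i q) (bubble K i)
  have h2 := degreeOf_pderiv_le q i j
  have h3 := degreeOf_bubble_le K i j
  have h4 := hq j
  split_ifs at h2 h3 with hj
  · subst hj; omega
  · omega

/-- A point of an interior face is in the plane of the side of both adjacent elements. -/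
theorem face_coord (F : InteriorFace T) (y : Fin 2 → ℝ) (s : Bool) :
    ((Face.axis (.inl F : Face T)).insertNth (Face.level (.inl F : Face T)) y : Fin 3 → ℝ) F.1.2.2
      = sideLevel (F.elem s).1 F.1.2.2 s := by
  rw [← F.level_eq s]
  exact Fin.insertNth_apply_same _ _ _

/-- Interior faces have positive area. -/
theorem volume_dom_pos (F : InteriorFace T) : 0 < volume.real (Face.dom (.inl F : Face T)) := by
  refine ENNReal.toReal_pos ?_ (Face.isCompact_dom _).measure_lt_top.ne
  let U : Set (Fin 2 → ℝ) := Set.univ.pi fun j =>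
    Set.Ioo (max (F.1.1.1.lower (F.1.2.2.succAbove j)) (F.1.2.1.1.lower (F.1.2.2.succAbove j)))
      (min (F.1.1.1.upper (F.1.2.2.succAbove j)) (F.1.2.1.1.upper (F.1.2.2.succAbove j)))
  have hU : IsOpen U := isOpen_set_pi Set.finite_univ fun _ _ => isOpen_Ioo
  have hne : U.Nonempty := Set.univ_pi_nonempty_iff.mpr fun j =>
    Set.nonempty_Ioo.mpr (F.2.2 _ (Fin.succAbove_ne _ _))
  have hsub : U ⊆ Face.dom (.inl F : Face T) := by
    intro y hy
    have hy' : ∀ s j, (F.elem s).1.lower (F.1.2.2.succAbove j) ≤ y j ∧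
        y j ≤ (F.elem s).1.upper (F.1.2.2.succAbove j) := by
      intro s j
      obtain ⟨h1, h2⟩ := hy j (Set.mem_univ j)
      rw [max_lt_iff] at h1
      rw [lt_min_iff] at h2
      cases s
      · exact ⟨h1.2.le, h2.2.le⟩
      · exact ⟨h1.1.le, h2.1.le⟩
    rw [mem_dom_inl]
    intro s
    rw [F.level_eq s]
    refine insertNth_mem_Icc_box.mpr ⟨?_, mem_Icc_box.mpr (hy' s)⟩
    have := (F.elem s).1.lower_le_upper F.1.2.2
    cases s <;> simp [sideLevel, this]
  exact ((hU.measure_pos volume hne).trans_le (measure_mono hsub)).ne'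

/-- A pressure in the kernel of `B_h` is piecewise constant: the velocities `∂_i q` times a bubble
do not see the faces. -/
theorem exists_eq_C_of_formB_eq_zero (hΩ : interior (closure Ω) = Ω) {q : FullPressure T k}
    (hq : ∀ v : Velocity T k, formB v q = 0) (K : T.elems) :
    ∃ c : ℝ, (q K).1 = MvPolynomial.C c := by
  let v : Velocity T k := fun K i => ⟨_, pderiv_mul_bubble_mem (q K).2 K.1 i⟩
  have h := hq v
  have hJ : integralFaces T (pressureJumpTerm v q) = 0 := by
    refine Finset.sum_eq_zero fun F _ => ?_
    rcases F with F | F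
    · refine integral_eq_zero_of_ae (Filter.Eventually.of_forall fun y => ?_)
      simp only [pressureJumpTerm, Pi.zero_apply]
      refine mul_eq_zero_of_right _ (Finset.sum_eq_zero fun s _ => ?_)
      have hz : MvPolynomial.eval
          ((Face.axis (.inl F : Face T)).insertNth (Face.level (.inl F : Face T)) y : Fin 3 → ℝ)
          (bubble (F.elem s).1 F.1.2.2) = 0 := by
        rw [eval_bubble, face_coord F y s]
        cases s <;> simp [sideLevel]
      simp only [v, map_mul, hz, mul_zero, zero_div]
    · simp [pressureJumpTerm]
  rw [formB_eq hΩ, hJ, add_zero] at h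
  have h0 := eq_zero_of_brokenIntegral_eq_zero (T := T)
    (p := fun i K => MvPolynomial.pderiv i (q K).1) (b := fun i K => bubble K.1 i)
    (fun i K x hx => by
      have := mem_Ioo_box.mp hx i
      rw [eval_bubble]
      exact mul_pos (by linarith) (by linarith)) (by
      rw [← h]
      congr 1)
  exact ⟨_, eq_C_of_pderiv_eq_zero fun i => congrFun (h0 i) K⟩

theorem affine_mem_restrictDegree (hk : 1 ≤ k) (i : Fin 3) (a b : ℝ) :
    MvPolynomial.C a - MvPolynomial.C b * MvPolynomial.X i ∈
      MvPolynomial.restrictDegree (Fin 3) ℝ k := by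
  rw [mem_restrictDegree_iff_degreeOf]
  intro j
  have h1 := MvPolynomial.degreeOf_sub_le j (MvPolynomial.C a)
    (MvPolynomial.C b * MvPolynomial.X i : MvPolynomial (Fin 3) ℝ)
  have h2 := MvPolynomial.degreeOf_C_mul_le (MvPolynomial.X i : MvPolynomial (Fin 3) ℝ) j b
  have h3 : (MvPolynomial.X i : MvPolynomial (Fin 3) ℝ).degreeOf j ≤ 1 := by
    rw [MvPolynomial.degreeOf_X]
    split_ifs <;> omega
  rw [MvPolynomial.degreeOf_C] at h1
  omega

/-- The kernel of `B_h` in the full pressure space consists of the constants. -/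
theorem exists_eq_constPressure (hΩ : interior (closure Ω) = Ω) (hconn : IsConnected Ω)
    (hk : 1 ≤ k) {q : FullPressure T k} (hq : ∀ v : Velocity T k, formB v q = 0) :
    ∃ c, q = constPressure T k c := by
  classical
  choose c hc using exists_eq_C_of_formB_eq_zero hΩ hq
  -- this velocity has the normal component `-q` on the upper and `q` on the lower sides, so that
  -- twice its average on a face is the jump of `q`
  let v : Velocity T k := fun K i => ⟨_, affine_mem_restrictDegree hk i
    (c K * (K.1.lower i + K.1.upper i) / (K.1.upper i - K.1.lower i))
    (c K * 2 / (K.1.upper i - K.1.lower i))⟩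
  have hv : ∀ (F : InteriorFace T) (s : Bool) (y : Fin 2 → ℝ), MvPolynomial.eval
      ((Face.axis (.inl F : Face T)).insertNth (Face.level (.inl F : Face T)) y : Fin 3 → ℝ)
      (v (F.elem s) F.1.2.2).1 = -sideSign s * c (F.elem s) := by
    intro F s y
    simp only [v, map_sub, map_mul, MvPolynomial.eval_C, MvPolynomial.eval_X, face_coord F y s]
    have h := sub_pos.mpr ((F.elem s).1.lower_lt_upper F.1.2.2)
    have h' := h.ne'
    cases s
    · simp only [sideLevel, sideSign, Bool.false_eq_true, if_false]
      field_simp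
      ring
    · simp only [sideLevel, sideSign, if_true]
      field_simp
      ring
  have h := hq v
  have h0 : (fun K : T.elems => ∑ i, MvPolynomial.pderiv i (q K).1 * (v K i).1) = 0 := by
    funext K
    simp [hc]
  rw [formB_eq hΩ, h0, map_zero, zero_add, integralFaces, sum_face] at h
  have hF : ∀ F : InteriorFace T, c (F.elem true) = c (F.elem false) := by
    have hval : ∀ F : InteriorFace T,
        ∫ y in {y : Fin 2 → ℝ | (Face.axis (.inl F : Face T)).insertNth
            (Face.level (.inl F : Face T)) y ∈ Face.carrier (.inl F : Face T)},
          pressureJumpTerm v q (.inl F) ((Face.axis (.inl F : Face T)).insertNth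
            (Face.level (.inl F : Face T)) y)
        = volume.real (Face.dom (.inl F : Face T)) *
            ((c (F.elem false) - c (F.elem true)) ^ 2 / 2) := by
      intro F
      simp only [pressureJumpTerm, hv, hc, MvPolynomial.eval_C, Fintype.sum_bool]
      rw [setIntegral_const, smul_eq_mul, Face.dom]
      simp only [sideSign, if_true, Bool.false_eq_true, if_false]
      ring
    have hbd : ∀ F : BoundaryFace T,
        (∫ y in {y : Fin 2 → ℝ | (Face.axis (.inr F : Face T)).insertNth
            (Face.level (.inr F : Face T)) y ∈ Face.carrier (.inr F : Face T)},
          pressureJumpTerm v q (.inr F) ((Face.axis (.inr F : Face T)).insertNth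
            (Face.level (.inr F : Face T)) y)) = 0 := by
      intro F
      simp [pressureJumpTerm]
    rw [Finset.sum_congr rfl fun F _ => hval F, Finset.sum_congr rfl fun F _ => hbd F,
      Finset.sum_const_zero, add_zero,
      Finset.sum_eq_zero_iff_of_nonneg fun F _ => by positivity] at h
    intro F
    have hF := h F (Finset.mem_univ F)
    rw [mul_eq_zero, or_iff_right (volume_dom_pos F).ne'] at hF
    have : (c (F.elem false) - c (F.elem true)) ^ 2 = 0 := by linarith
    linarith [pow_eq_zero_iff (two_ne_zero) |>.mp this]
  have hopen : IsOpen Ω := hΩ ▸ isOpen_interior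
  rcases isEmpty_or_nonempty T.elems with hE | ⟨⟨K₀⟩⟩
  · exact ⟨0, funext fun K => hE.elim K⟩
  refine ⟨c K₀, funext fun K => Subtype.ext ?_⟩
  have huniv := eq_univ_of_face_invariant hopen hconn.isPreconnected (S := {K | c K = c K₀})
    (fun F => by simp only [Set.mem_ofPred_eq, hF F]) ⟨K₀, rfl⟩
  have hK : c K = c K₀ := Set.eq_univ_iff_forall.mp huniv K
  rw [hc, hK]
  rfl

/-! ### Linearity of the forms -/

theorem comp_add (u v : Velocity T k) (i : Fin 3) : (u + v).comp i = u.comp i + v.comp i := rfl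

theorem comp_smul (c : ℝ) (u : Velocity T k) (i : Fin 3) : (c • u).comp i = c • u.comp i := rfl

theorem grad_add (u v : Velocity T k) (i j : Fin 3) :
    (u + v).grad i j = u.grad i j + v.grad i j := by
  funext K; simp [Velocity.grad]

theorem grad_smul (c : ℝ) (u : Velocity T k) (i j : Fin 3) :
    (c • u).grad i j = c • u.grad i j := by
  funext K; simp [Velocity.grad]

theorem div_add (u v : Velocity T k) : (u + v).div = u.div + v.div := by
  funext K; simp [Velocity.div, Finset.sum_add_distrib]

theorem div_smul (c : ℝ) (u : Velocity T k) : (c • u).div = c • u.div := by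
  funext K; simp [Velocity.div, Finset.smul_sum]

theorem toBroken_add (p q : FullPressure T k) :
    (p + q).toBroken = p.toBroken + q.toBroken := rfl

theorem toBroken_smul (c : ℝ) (q : FullPressure T k) : (c • q).toBroken = c • q.toBroken := rfl

/-- The form `A_h` as a bilinear map. -/
noncomputable def bilinA (T : BoxMesh Ω) (k : ℕ) (γ θ : ℝ) :
    Velocity T k →ₗ[ℝ] Velocity T k →ₗ[ℝ] ℝ :=
  LinearMap.mk₂ ℝ (formA γ θ)
    (fun u u' v => by
      have h1 : gradDot (u + u') v = gradDot u v + gradDot u' v := by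
        simp only [gradDot, grad_add, add_mul, Finset.sum_add_distrib]
      have h2 : fluxTerm θ (u + u') v = fun F x => fluxTerm θ u v F x + fluxTerm θ u' v F x := by
        funext F x
        simp only [fluxTerm, grad_add, comp_add, avg_add, jump_add, ← Finset.sum_add_distrib]
        exact Finset.sum_congr rfl fun i _ => Finset.sum_congr rfl fun j _ => by ring
      have h3 : penaltyTerm (u + u') v = fun F x =>
          penaltyTerm u v F x + penaltyTerm u' v F x := by
        funext F x
        simp only [penaltyTerm, comp_add, jump_add, add_mul, Finset.sum_add_distrib, mul_add]
      rw [formA_def, formA_def, formA_def, h1, h2, h3, map_add,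
        integralFaces_add (continuous_fluxTerm _ _ _) (continuous_fluxTerm _ _ _),
        integralFaces_add (continuous_penaltyTerm _ _) (continuous_penaltyTerm _ _)]
      ring)
    (fun c u v => by
      have h1 : gradDot (c • u) v = c • gradDot u v := by
        simp only [gradDot, grad_smul, smul_mul_assoc, Finset.smul_sum]
      have h2 : fluxTerm θ (c • u) v = fun F x => c * fluxTerm θ u v F x := by
        funext F x
        simp only [fluxTerm, grad_smul, comp_smul, avg_smul, jump_smul, Finset.mul_sum]
        exact Finset.sum_congr rfl fun i _ => Finset.sum_congr rfl fun j _ => by ring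
      have h3 : penaltyTerm (c • u) v = fun F x => c * penaltyTerm u v F x := by
        funext F x
        simp only [penaltyTerm, comp_smul, jump_smul, Finset.mul_sum]
        exact Finset.sum_congr rfl fun i _ => Finset.sum_congr rfl fun j _ => by ring
      rw [formA_def, formA_def, h1, h2, h3, map_smul, integralFaces_const_mul,
        integralFaces_const_mul, smul_eq_mul, smul_eq_mul]
      ring)
    (fun u v v' => by
      have h1 : gradDot u (v + v') = gradDot u v + gradDot u v' := by
        simp only [gradDot, grad_add, mul_add, Finset.sum_add_distrib]
      have h2 : fluxTerm θ u (v + v') = fun F x => fluxTerm θ u v F x + fluxTerm θ u v' F x := by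
        funext F x
        simp only [fluxTerm, grad_add, comp_add, avg_add, jump_add, ← Finset.sum_add_distrib]
        exact Finset.sum_congr rfl fun i _ => Finset.sum_congr rfl fun j _ => by ring
      have h3 : penaltyTerm u (v + v') = fun F x =>
          penaltyTerm u v F x + penaltyTerm u v' F x := by
        funext F x
        simp only [penaltyTerm, comp_add, jump_add, Finset.sum_add_distrib, mul_add]
      rw [formA_def, formA_def, formA_def, h1, h2, h3, map_add,
        integralFaces_add (continuous_fluxTerm _ _ _) (continuous_fluxTerm _ _ _),
        integralFaces_add (continuous_penaltyTerm _ _) (continuous_penaltyTerm _ _)]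
      ring)
    (fun c u v => by
      have h1 : gradDot u (c • v) = c • gradDot u v := by
        simp only [gradDot, grad_smul, mul_smul_comm, Finset.smul_sum]
      have h2 : fluxTerm θ u (c • v) = fun F x => c * fluxTerm θ u v F x := by
        funext F x
        simp only [fluxTerm, grad_smul, comp_smul, avg_smul, jump_smul, Finset.mul_sum]
        exact Finset.sum_congr rfl fun i _ => Finset.sum_congr rfl fun j _ => by ring
      have h3 : penaltyTerm u (c • v) = fun F x => c * penaltyTerm u v F x := by
        funext F x
        simp only [penaltyTerm, comp_smul, jump_smul, Finset.mul_sum]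
        exact Finset.sum_congr rfl fun i _ => Finset.sum_congr rfl fun j _ => by ring
      rw [formA_def, formA_def, h1, h2, h3, map_smul, integralFaces_const_mul,
        integralFaces_const_mul, smul_eq_mul, smul_eq_mul]
      ring)

theorem bilinA_apply (γ θ : ℝ) (u v : Velocity T k) : bilinA T k γ θ u v = formA γ θ u v := rfl

/-- The form `B_h` as a bilinear map. -/
noncomputable def bilinB (T : BoxMesh Ω) (k : ℕ) :
    Velocity T k →ₗ[ℝ] FullPressure T k →ₗ[ℝ] ℝ :=
  have hc : ∀ (v : Velocity T k) (q : FullPressure T k) (F : Face T), Continuous fun x =>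
      F.avg q.toBroken x * ∑ j, F.jump (v.comp j) j x := fun v q F =>
    (continuous_avg _ F).mul (continuous_finsetSum _ fun j _ => continuous_jump _ _ F)
  LinearMap.mk₂ ℝ formB
    (fun v v' q => by
      have h : (fun (F : Face T) x => F.avg q.toBroken x * ∑ j, F.jump ((v + v').comp j) j x) =
          fun F x => F.avg q.toBroken x * ∑ j, F.jump (v.comp j) j x
            + F.avg q.toBroken x * ∑ j, F.jump (v'.comp j) j x := by
        funext F x
        simp only [comp_add, jump_add, Finset.sum_add_distrib, mul_add]
      rw [formB_def, formB_def, formB_def, div_add, mul_add, map_add, h,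
        integralFaces_add (hc v q) (hc v' q)]
      ring)
    (fun c v q => by
      have h : (fun (F : Face T) x => F.avg q.toBroken x * ∑ j, F.jump ((c • v).comp j) j x) =
          fun F x => c * (F.avg q.toBroken x * ∑ j, F.jump (v.comp j) j x) := by
        funext F x
        simp only [comp_smul, jump_smul, ← Finset.mul_sum]
        ring
      rw [formB_def, formB_def, div_smul, mul_smul_comm, map_smul, h, integralFaces_const_mul,
        smul_eq_mul, smul_eq_mul]
      ring)
    (fun v q q' => by
      have h : (fun (F : Face T) x =>
            F.avg (q + q').toBroken x * ∑ j, F.jump (v.comp j) j x) =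
          fun F x => F.avg q.toBroken x * ∑ j, F.jump (v.comp j) j x
            + F.avg q'.toBroken x * ∑ j, F.jump (v.comp j) j x := by
        funext F x
        simp only [toBroken_add, avg_add, add_mul]
      rw [formB_def, formB_def, formB_def, h, integralFaces_add (hc v q) (hc v q'), toBroken_add,
        add_mul, map_add]
      ring)
    (fun c v q => by
      have h : (fun (F : Face T) x => F.avg (c • q).toBroken x * ∑ j, F.jump (v.comp j) j x) =
          fun F x => c * (F.avg q.toBroken x * ∑ j, F.jump (v.comp j) j x) := by
        funext F x
        simp only [toBroken_smul, avg_smul]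
        ring
      rw [formB_def, formB_def, h, integralFaces_const_mul, toBroken_smul, smul_mul_assoc,
        map_smul, smul_eq_mul, smul_eq_mul]
      ring)

theorem bilinB_apply (v : Velocity T k) (q : FullPressure T k) : bilinB T k v q = formB v q := rfl

theorem formC_eq (ν : ℝ) (p q : FullPressure T k) :
    formC ν p q = (1 - 2 * ν) * brokenIntegral T (p.toBroken * q.toBroken) := by
  rw [formC, ← integral_fn]
  simp only [Broken.fn_mul]

/-- The form `C_h` as a bilinear map. -/
noncomputable def bilinC (T : BoxMesh Ω) (k : ℕ) (ν : ℝ) :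
    FullPressure T k →ₗ[ℝ] FullPressure T k →ₗ[ℝ] ℝ :=
  LinearMap.mk₂ ℝ (formC ν)
    (fun p p' q => by simp only [formC_eq, toBroken_add, add_mul, map_add]; ring)
    (fun c p q => by
      simp only [formC_eq, toBroken_smul, smul_mul_assoc, map_smul, smul_eq_mul]; ring)
    (fun p q q' => by simp only [formC_eq, toBroken_add, mul_add, map_add])
    (fun c p q => by
      simp only [formC_eq, toBroken_smul, mul_smul_comm, map_smul, smul_eq_mul]; ring)

theorem bilinC_apply (ν : ℝ) (p q : FullPressure T k) : bilinC T k ν p q = formC ν p q := rfl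

/-- The integral of a pressure, as a linear form. -/
noncomputable def pressureIntegral (T : BoxMesh Ω) (k : ℕ) : FullPressure T k →ₗ[ℝ] ℝ where
  toFun q := brokenIntegral T q.toBroken
  map_add' p q := by rw [toBroken_add, map_add]
  map_smul' c q := by rw [toBroken_smul, map_smul, RingHom.id_apply]

theorem pressureIntegral_apply (q : FullPressure T k) :
    pressureIntegral T k q = ∫ x in Ω, q.toBroken.fn x := (integral_fn _).symm

theorem memLp_fn (g : Broken T) : MemLp g.fn 2 (volume.restrict Ω) := by
  have h : g.fn = ∑ K : T.elems, (BoxIntegral.Box.Ioo K.1).indicator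
      (fun y => MvPolynomial.eval y (g K)) := by
    funext x
    rw [Finset.sum_apply]
    rfl
  rw [h]
  refine memLp_finsetSum' _ fun K _ => MemLp.restrict _ ?_
  have hm := (isOpen_Ioo_box K.1).measurableSet
  rw [memLp_indicator_iff_restrict hm]
  obtain ⟨C, hC⟩ := K.1.isCompact_Icc.exists_bound_of_continuousOn
    (MvPolynomial.continuous_eval (g K)).continuousOn
  have : IsFiniteMeasure (volume.restrict (BoxIntegral.Box.Ioo K.1)) :=
    ⟨by
      rw [Measure.restrict_apply_univ]
      exact (measure_mono K.1.Ioo_subset_Icc).trans_lt K.1.isCompact_Icc.measure_lt_top⟩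
  refine MemLp.of_bound (MvPolynomial.continuous_eval (g K)).aestronglyMeasurable C ?_
  exact ae_restrict_of_forall_mem hm fun x hx => hC x (K.1.Ioo_subset_Icc hx)

/-- The load functional as a linear form. Square integrability of `f` makes the integrals exist, on
which additivity depends. -/
noncomputable def linLoad (T : BoxMesh Ω) (k : ℕ) (f : (Fin 3 → ℝ) → Fin 3 → ℝ)
    (hf : MemLp f 2 (volume.restrict Ω)) : Velocity T k →ₗ[ℝ] ℝ where
  toFun := load f
  map_add' v w := by
    have hi : ∀ v : Velocity T k, Integrable (fun x => ∑ i, f x i * (v.comp i).fn x)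
        (volume.restrict Ω) := fun v =>
      integrable_finsetSum _ fun i _ => (hf.eval i).integrable_mul (memLp_fn _)
    rw [load, load, load, ← integral_add (hi v) (hi w)]
    simp only [comp_add, Broken.fn_add, mul_add, Finset.sum_add_distrib]
  map_smul' c v := by
    rw [load, load, RingHom.id_apply, smul_eq_mul, ← integral_const_mul]
    refine integral_congr_ae (Filter.Eventually.of_forall fun x => ?_)
    simp only [comp_smul, Broken.fn_smul, Finset.mul_sum]
    exact Finset.sum_congr rfl fun i _ => by ring

/-! ### Equivalence of the two problems and well-posedness -/

theorem setAverage_pressure (p : FullPressure T k) :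
    ⨍ x in Ω, p.toBroken.fn x = (volume.real Ω)⁻¹ * pressureIntegral T k p := by
  rw [setAverage_eq, pressureIntegral_apply, smul_eq_mul]

theorem pressureIntegral_constPressure (hΩ : IsOpen Ω) (c : ℝ) :
    pressureIntegral T k (constPressure T k c) = c * volume.real Ω := by
  change brokenIntegral T (constPressure T k c).toBroken = _
  rw [toBroken_constPressure, map_smul, brokenIntegral_one hΩ, smul_eq_mul]

theorem formC_constPressure (ν : ℝ) (p : FullPressure T k) (c : ℝ) :
    formC ν p (constPressure T k c) = (1 - 2 * ν) * (c * pressureIntegral T k p) := by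
  rw [formC_eq, toBroken_constPressure, mul_smul_comm, mul_one, map_smul, smul_eq_mul]
  rfl

theorem mem_Pressure {p : FullPressure T k} : p ∈ Pressure T k ↔ pressureIntegral T k p = 0 := by
  rw [pressureIntegral_apply]
  rfl

/-- The augmented problem is equivalent to the mixed one. Since constants are in the kernel of
`B_h`, testing with `q = 1` gives `2 ν r = 0`. -/
theorem isAugmentedSolution_iff (hΩ : interior (closure Ω) = Ω) (hne : Ω.Nonempty)
    {γ θ ν : ℝ} (hν : 0 < ν) (f : (Fin 3 → ℝ) → Fin 3 → ℝ) (u : Velocity T k)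
    (p : FullPressure T k) (r : ℝ) :
    IsAugmentedSolution γ θ ν f u p r ↔ r = 0 ∧ IsMixedSolution γ θ ν f u p := by
  have hopen : IsOpen Ω := hΩ ▸ isOpen_interior
  have hvol := measureReal_pos T hopen hne
  simp only [IsAugmentedSolution, IsMixedSolution, setAverage_pressure, mem_Pressure,
    ← pressureIntegral_apply]
  constructor
  · rintro ⟨h1, h2, h3⟩
    have hr : pressureIntegral T k p = r * volume.real Ω := by
      have := h3 1
      field_simp at this
      linarith
    have h4 := h2 (constPressure T k 1)
    rw [formB_constPressure hΩ, formC_constPressure, pressureIntegral_constPressure hopen, hr] at h4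
    have h5 : ν * volume.real Ω * r = 0 := by linarith
    have hr0 : r = 0 := by
      simpa [hν.ne', hvol.ne'] using h5
    subst hr0
    refine ⟨rfl, by simpa using hr, h1, fun q _ => ?_⟩
    simpa using h2 q
  · rintro ⟨rfl, hp, h1, h2⟩
    refine ⟨h1, fun q => ?_, fun s => by simp [hp]⟩
    -- split `q` into its mean value and a pressure with vanishing mean
    set c := pressureIntegral T k q / volume.real Ω with hc
    have hq : pressureIntegral T k (q - constPressure T k c) = 0 := by
      rw [map_sub, pressureIntegral_constPressure hopen, hc]
      field_simp
      ring
    have h := h2 _ hq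
    rw [← bilinB_apply, ← bilinC_apply, map_sub, map_sub, bilinB_apply, bilinB_apply, bilinC_apply,
      bilinC_apply, formB_constPressure hΩ, formC_constPressure, hp] at h
    linarith

/-- The mixed problem without load has the trivial solution only. -/
theorem eq_zero_of_isMixedSolution (hΩ : interior (closure Ω) = Ω) (hconn : IsConnected Ω)
    (hk : 1 ≤ k) {γ θ ν : ℝ} (hθ : θ ∈ Set.Icc (-1 : ℝ) 1) (hγ : 17 ≤ γ)
    (hν : ν ∈ Set.Ioc (0 : ℝ) (1 / 2)) {u : Velocity T k} {p : FullPressure T k}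
    (h : IsMixedSolution γ θ ν (fun _ => 0) u p) : u = 0 ∧ p = 0 := by
  obtain ⟨hp, h1, h2⟩ := h
  have hload : ∀ v : Velocity T k, load (fun _ => 0) v = 0 := fun v => by simp [load]
  have hC : 0 ≤ formC ν p p := by
    rw [formC_eq]
    refine mul_nonneg (by linarith [hν.2]) (brokenIntegral_nonneg fun K x _ => ?_)
    simp only [Pi.mul_apply, map_mul]
    exact mul_self_nonneg _
  have hu : u = 0 := by
    refine eq_zero_of_formA_self_nonpos hΩ hk hθ hγ u ?_
    have a := h1 u
    have b := h2 p hp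
    rw [hload] at a
    linarith
  subst hu
  refine ⟨rfl, ?_⟩
  have hB : ∀ v : Velocity T k, formB v p = 0 := by
    intro v
    have a := h1 v
    rwa [hload, ← bilinA_apply, map_zero, LinearMap.zero_apply, zero_add] at a
  obtain ⟨c, rfl⟩ := exists_eq_constPressure hΩ hconn hk hB
  have hopen : IsOpen Ω := hΩ ▸ isOpen_interior
  rw [mem_Pressure, pressureIntegral_constPressure hopen, mul_eq_zero,
    or_iff_left (measureReal_pos T hopen hconn.nonempty).ne'] at hp
  subst hp
  funext K
  exact Subtype.ext (by simp [constPressure])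

/-- The operator of the augmented problem, on the product of the three unknowns. -/
noncomputable def augmentedOperator (T : BoxMesh Ω) (k : ℕ) (γ θ ν : ℝ) :
    (Velocity T k × FullPressure T k × ℝ) →ₗ[ℝ]
      Module.Dual ℝ (Velocity T k × FullPressure T k × ℝ) :=
  LinearMap.mk₂ ℝ
    (fun x y => (bilinA T k γ θ x.1 y.1 + bilinB T k y.1 x.2.1)
      + (-bilinB T k x.1 y.2.1 + bilinC T k ν x.2.1 y.2.1 - x.2.2 * pressureIntegral T k y.2.1)
      + (y.2.2 * ((volume.real Ω)⁻¹ * pressureIntegral T k x.2.1) - x.2.2 * y.2.2))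
    (fun x x' y => by
      simp only [Prod.fst_add, Prod.snd_add, map_add, LinearMap.add_apply]; ring)
    (fun c x y => by
      simp only [Prod.smul_fst, Prod.smul_snd, map_smul, LinearMap.smul_apply, smul_eq_mul]; ring)
    (fun x y y' => by
      simp only [Prod.fst_add, Prod.snd_add, map_add, LinearMap.add_apply]; ring)
    (fun c x y => by
      simp only [Prod.smul_fst, Prod.smul_snd, map_smul, LinearMap.smul_apply, smul_eq_mul]; ring)

/-- The three equations are the operator equation tested with `(v, 0, 0)`, `(0, q, 0)`
and `(0, 0, s)`. -/
theorem isAugmentedSolution_iff_operator {γ θ ν : ℝ} {f : (Fin 3 → ℝ) → Fin 3 → ℝ}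
    (hf : MemLp f 2 (volume.restrict Ω)) (u : Velocity T k) (p : FullPressure T k) (r : ℝ) :
    IsAugmentedSolution γ θ ν f u p r ↔
      augmentedOperator T k γ θ ν (u, p, r) = linLoad T k f hf ∘ₗ LinearMap.fst ℝ _ _ := by
  have hl : ∀ v, linLoad T k f hf v = load f v := fun _ => rfl
  rw [LinearMap.ext_iff]
  simp only [IsAugmentedSolution, setAverage_pressure, ← pressureIntegral_apply,
    LinearMap.comp_apply, LinearMap.fst_apply, hl, augmentedOperator, LinearMap.mk₂_apply,
    ← bilinA_apply, ← bilinB_apply, ← bilinC_apply]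
  constructor
  · rintro ⟨h1, h2, h3⟩ y
    linarith [h1 y.1, h2 y.2.1, h3 y.2.2]
  · intro h
    have h0 : load f (0 : Velocity T k) = 0 := (linLoad T k f hf).map_zero
    refine ⟨fun v => ?_, fun q => ?_, fun s => ?_⟩
    · simpa using h (v, 0, 0)
    · simpa [h0] using h (0, q, 0)
    · simpa [h0] using h (0, 0, s)

/-- For `γ ≥ 17`, the augmented problem has a unique solution: its operator between spaces of the
same finite dimension is injective. -/
theorem existsUnique_augmentedSolution (hΩ : interior (closure Ω) = Ω) (hconn : IsConnected Ω)
    (hk : 1 ≤ k) {γ θ ν : ℝ} (hθ : θ ∈ Set.Icc (-1 : ℝ) 1) (hγ : 17 ≤ γ)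
    (hν : ν ∈ Set.Ioc (0 : ℝ) (1 / 2)) {f : (Fin 3 → ℝ) → Fin 3 → ℝ}
    (hf : MemLp f 2 (volume.restrict Ω)) :
    ∃! x : Velocity T k × FullPressure T k × ℝ, IsAugmentedSolution γ θ ν f x.1 x.2.1 x.2.2 := by
  have hinj : Function.Injective (augmentedOperator T k γ θ ν) := by
    rw [← LinearMap.ker_eq_bot, LinearMap.ker_eq_bot']
    rintro ⟨u, p, r⟩ h
    have hf0 : MemLp (fun _ : Fin 3 → ℝ => (0 : Fin 3 → ℝ)) 2 (volume.restrict Ω) := MemLp.zero'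
    have hl0 : linLoad T k (fun _ => 0) hf0 = 0 := by
      ext1 v
      change load (fun _ => 0) v = 0
      simp [load]
    have hs : IsAugmentedSolution γ θ ν (fun _ => 0) u p r := by
      rw [isAugmentedSolution_iff_operator hf0, h, hl0, LinearMap.zero_comp]
    obtain ⟨rfl, hm⟩ := (isAugmentedSolution_iff hΩ hconn.nonempty hν.1 _ _ _ _).mp hs
    obtain ⟨rfl, rfl⟩ := eq_zero_of_isMixedSolution hΩ hconn hk hθ hγ hν hm
    rfl
  have hsurj : Function.Surjective (augmentedOperator T k γ θ ν) :=
    (LinearMap.injective_iff_surjective_of_finrank_eq_finrank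
      Subspace.dual_finrank_eq.symm).mp hinj
  obtain ⟨x, hx⟩ := hsurj (linLoad T k f hf ∘ₗ LinearMap.fst ℝ _ _)
  refine ⟨x, (isAugmentedSolution_iff_operator hf _ _ _).mpr hx, fun y hy => hinj ?_⟩
  rw [hx]
  exact (isAugmentedSolution_iff_operator hf _ _ _).mp hy

end MixedDG

theorem mainTheorem1 :
    ∃ γ₀ : ℝ, 0 < γ₀ ∧
      ∀ (Ω : Set (Fin 3 → ℝ)), IsOpen Ω → IsConnected Ω → interior (closure Ω) = Ω →
      ∀ (T : MixedDG.BoxMesh Ω) (k : ℕ), 1 ≤ k →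
      ∀ (θ : ℝ), θ ∈ Set.Icc (-1 : ℝ) 1 →
      ∀ (γ : ℝ), 0 < γ →
      ∀ (ν : ℝ), ν ∈ Set.Ioc (0 : ℝ) (1 / 2) →
      ∀ (f : (Fin 3 → ℝ) → Fin 3 → ℝ), MemLp f 2 (volume.restrict Ω) →
        (∀ (u : MixedDG.Velocity T k) (p : MixedDG.FullPressure T k) (r : ℝ),
          MixedDG.IsAugmentedSolution γ θ ν f u p r ↔
            r = 0 ∧ MixedDG.IsMixedSolution γ θ ν f u p) ∧
        (γ₀ ≤ γ →
          ∃ (u : MixedDG.Velocity T k) (p : MixedDG.FullPressure T k),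
            MixedDG.IsAugmentedSolution γ θ ν f u p 0 ∧
            (∀ (u' : MixedDG.Velocity T k) (p' : MixedDG.FullPressure T k) (r' : ℝ),
              MixedDG.IsAugmentedSolution γ θ ν f u' p' r' → u' = u ∧ p' = p ∧ r' = 0) ∧
            p ∈ MixedDG.Pressure T k ∧
            MixedDG.IsMixedSolution γ θ ν f u p ∧
            (∀ (u' : MixedDG.Velocity T k) (p' : MixedDG.FullPressure T k),
              MixedDG.IsMixedSolution γ θ ν f u' p' → u' = u ∧ p' = p)) := by
  refine ⟨17, by norm_num, ?_⟩
  intro Ω _ hconn hΩ T k hk θ hθ γ _ ν hν f hf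
  have hiff : ∀ (u : MixedDG.Velocity T k) (p : MixedDG.FullPressure T k) (r : ℝ),
      MixedDG.IsAugmentedSolution γ θ ν f u p r ↔ r = 0 ∧ MixedDG.IsMixedSolution γ θ ν f u p :=
    MixedDG.isAugmentedSolution_iff hΩ hconn.nonempty hν.1 f
  refine ⟨hiff, fun hγ => ?_⟩
  obtain ⟨⟨u, p, r⟩, hsol, huniq⟩ :=
    MixedDG.existsUnique_augmentedSolution (T := T) hΩ hconn hk hθ hγ hν hf
  obtain ⟨rfl, hm⟩ := (hiff u p r).mp hsol
  have huniq' : ∀ (u' : MixedDG.Velocity T k) (p' : MixedDG.FullPressure T k) (r' : ℝ),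
      MixedDG.IsAugmentedSolution γ θ ν f u' p' r' → u' = u ∧ p' = p ∧ r' = 0 := by
    intro u' p' r' h
    simpa using huniq (u', p', r') h
  refine ⟨u, p, hsol, huniq', hm.1, hm, fun u' p' h => ?_⟩
  have h' := huniq' u' p' 0 ((hiff u' p' 0).mpr ⟨rfl, h⟩)
  exact ⟨h'.1, h'.2.1⟩
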